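/- Let $F$ be a probability distribution on $\mathbb R$ with finite mean whose tail $\overline F(x)=F(x,\infty)$ is regularly varying: $\overline F(x)=L(x)/x^{\alpha}$ for $x>0$, with $\alpha>0$ and $L$ slowly varying at infinity. For a function $f$ and a constant $c\ge 0$ write $f(x)\sim c\,\overline F(x)$ if $f(x)/\overline F(x)\to c$ as $x\to\infty$ (so $f=o(\overline F)$ when $c=0$). Put $\|v\|=|v_1|+\cdots+|v_p|$ for $v\in\mathbb R^p$. Let $N=(N_1,\ldots,N_p)$ be a random vector with values in $\{0,1,2,\ldots\}^p$ which is multivariate regularly varying with respect to $F$: $\mathbb P(\|N\|>x)\sim c_N\overline F(x)$, where either $c_N=0$, or $c_N>0$ and the conditional distribution of $N/\|N\|$ given $\|N\|>x$ converges weakly, as $x\to\infty$, to a probability measure on $\{\theta\in\mathbb R^p:\|\theta\|=1\}$. Let $Z^{(j)}_m$ ($j=1,\ldots,p$, $m=1,2,\ldots$) be mutually independent real random variables, independent of $N$, where $Z^{(j)}_m$ has a distribution $F_j$ that does not depend on $m$, has finite mean $\overline z_j$, and satisfies $\overline F_j(x)\sim c_j\overline F(x)$ with $c_j\ge 0$.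 Put $S^{(j)}_n=Z^{(j)}_1+\cdots+Z^{(j)}_n$ and $c_0=c_1\mathbb E N_1+\cdots+c_p\mathbb E N_p$. Then every $\mathbb E N_j$ is finite, and as $x\to\infty$ $$\mathbb P\bigl(S^{(1)}_{N_1}+\cdots+S^{(p)}_{N_p}>x\bigr)=\mathbb P\bigl(\overline z_1N_1+\cdots+\overline z_pN_p>x\bigr)+c_0\overline F(x)+o\bigl(\overline F(x)\bigr).$$ Consequently, unless $\mathbb P(\overline z_1N_1+\cdots+\overline z_pN_p>x)+c_0\overline F(x)=o(\overline F(x))$ (for instance, if $c_0>0$, or if $c_N>0$ and all $\overline z_j>0$), $$\mathbb P\bigl(S^{(1)}_{N_1}+\cdots+S^{(p)}_{N_p}>x\bigr)\ \sim\ \mathbb P\bigl(\overline z_1N_1+\cdots+\overline z_pN_p>x\bigr)+c_0\overline F(x),$$ i.e. the ratio of the two sides tends to $1$. -/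

import Mathlib

open MeasureTheory ProbabilityTheory Filter Topology Asymptotics

noncomputable section

namespace RandomSum

/-- The tail `x ↦ F (x, ∞)` of a distribution `F` on the real line. -/
def tail (F : Measure ℝ) (x : ℝ) : ℝ := F.real (Set.Ioi x)

/-- `L` is slowly varying at infinity. -/
structure IsSlowlyVarying (L : ℝ → ℝ) : Prop where
  measurable : Measurable L
  eventually_pos : ∀ᶠ x in atTop, 0 < L x
  tendsto : ∀ t : ℝ, 0 < t → Tendsto (fun x => L (t * x) / L x) atTop (𝓝 1)

/-- `F` is regularly varying with index `α > 0`: its tail is `L x / x ^ α` on `(0, ∞)` for some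
slowly varying `L`. -/
def IsRegularlyVarying (F : Measure ℝ) (α : ℝ) : Prop :=
  0 < α ∧ ∃ L : ℝ → ℝ, IsSlowlyVarying L ∧ ∀ x : ℝ, 0 < x → tail F x = L x / x ^ α

/-- `f x ~ c * g x` as `x → ∞`, where for `c = 0` this means that `f` is negligible with respect
to `g`. It is used for functions `g` which are positive near infinity. -/
def TailEquiv (f : ℝ → ℝ) (c : ℝ) (g : ℝ → ℝ) : Prop :=
  Tendsto (fun x => f x / g x) atTop (𝓝 c)

/-- The `L₁` norm of a vector. -/
def norm₁ {p : ℕ} (v : Fin p → ℝ) : ℝ := ∑ i, |v i|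

/-- The angular part `v / ‖v‖₁` of a vector (only used for vectors `v ≠ 0`). -/
def angular {p : ℕ} (v : Fin p → ℝ) : Fin p → ℝ := (norm₁ v)⁻¹ • v

/-- The random vector `V` satisfies `MRV(F)`, with constant `b`: one has
`P(‖V‖₁ > x) ~ b * tail F x` and, unless `b = 0`, the conditional law of `V / ‖V‖₁`
given `‖V‖₁ > x` converges weakly to a probability measure on the `L₁` unit sphere. -/
def MRV {Ω : Type*} [MeasurableSpace Ω] (P : Measure Ω) (F : Measure ℝ) {p : ℕ}
    (V : Ω → Fin p → ℝ) (b : ℝ) : Prop :=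
  TailEquiv (fun x => P.real {ω | x < norm₁ (V ω)}) b (tail F) ∧
    (b = 0 ∨
      (0 < b ∧ ∃ μ : Measure (Fin p → ℝ), IsProbabilityMeasure μ ∧ (∀ᵐ θ ∂μ, norm₁ θ = 1) ∧
        ∀ f : BoundedContinuousFunction (Fin p → ℝ) ℝ,
          Tendsto (fun x : ℝ => ∫ ω, f (angular (V ω)) ∂(P[|{ω | x < norm₁ (V ω)}]))
            atTop (𝓝 (∫ θ, f θ ∂μ))))

/-- The randomly stopped partial sum `Z 0 + ⋯ + Z (N - 1)`. -/
def randomSum {Ω : Type*} (Z : ℕ → Ω → ℝ) (N : Ω → ℕ) (ω : Ω) : ℝ :=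
  ∑ m ∈ Finset.range (N ω), Z m ω

end RandomSum

end

/-! Write S for the random sum, T for the total number of summands and U for the linear form of N
with the means as coefficients. S exceeds x for one of two reasons, separated by whether T is at
most εx.

If T ≤ εx, the centre U is too small to explain the excess, and one summand must be huge.
Conditionally on N = n, the probability that S > x, divided by the reference tail, tends to the sum
of the c_j n_j (`TailEquiv.sum_of_iIndepFun`). It is bounded by C times the number of summands as
long as that number is at most εx (`exists_measure_sum_gt_le`). Since T is integrable, dominated
convergence gives the term with c_0 (`exists_tailEquiv_randomSum_small`). The uniform bound is a
truncation argument: either some summand exceeds y = x/(2q), or the sum of the truncated summands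
reaches x, and an exponential inequality makes the latter small.

If T > εx, the law of large numbers puts S within δx of U, so S > x and U > x differ only when T is
extremely large, when the law of large numbers fails, or when U is within δx of x
(`tailEquiv_randomSum_large`). The first two events are small relative to the reference tail because
T has a tail of that order. The third is small because the tail of U is asymptotically a constant
multiple of the reference tail. This is where the angular convergence enters
(`MRV.exists_tailEquiv_linear`): on a small piece of the unit sphere a linear form is almost a
constant multiple of the norm. -/

noncomputable section

namespace RandomSum

/-! ### Regularly varying tails: rescaling and polynomial bounds -/

section Tail

variable {F : Measure ℝ} {α : ℝ}

theorem tail_nonneg (F : Measure ℝ) (x : ℝ) : 0 ≤ tail F x := measureReal_nonneg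

theorem tail_antitone (F : Measure ℝ) [IsFiniteMeasure F] : Antitone (tail F) := fun _ _ h =>
  measureReal_mono (Set.Ioi_subset_Ioi h)

theorem IsRegularlyVarying.tail_pos [IsFiniteMeasure F] (hF : IsRegularlyVarying F α) (x : ℝ) :
    0 < tail F x := by
  obtain ⟨_, L, hL, h⟩ := hF
  obtain ⟨y, hLy, hy, hxy⟩ :=
    (hL.eventually_pos.and ((eventually_gt_atTop 0).and (eventually_ge_atTop x))).exists
  refine lt_of_lt_of_le ?_ (tail_antitone F hxy)
  rw [h y hy]
  positivity

theorem IsRegularlyVarying.tendsto_tail_ratio (hF : IsRegularlyVarying F α) {t : ℝ} (ht : 0 < t) :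
    Tendsto (fun x => tail F (t * x) / tail F x) atTop (𝓝 (t ^ (-α))) := by
  obtain ⟨_, L, hL, h⟩ := hF
  have h1 := (hL.tendsto t ht).mul_const (t ^ (-α))
  rw [one_mul] at h1
  refine h1.congr' ?_
  filter_upwards [eventually_gt_atTop 0, hL.eventually_pos] with x hx hLx
  rw [h x hx, h (t * x) (by positivity), Real.mul_rpow ht.le hx.le, Real.rpow_neg ht.le]
  have := Real.rpow_pos_of_pos hx α
  have := Real.rpow_pos_of_pos ht α
  field_simp

/-- Rescaling the argument of a function which is equivalent to a regularly varying tail. -/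
theorem TailEquiv.comp_mul [IsFiniteMeasure F] (hF : IsRegularlyVarying F α) {f : ℝ → ℝ} {c : ℝ}
    (hf : TailEquiv f c (tail F)) {t : ℝ} (ht : 0 < t) :
    TailEquiv (fun x => f (t * x)) (c * t ^ (-α)) (tail F) := by
  have h1 : Tendsto (fun x => f (t * x) / tail F (t * x)) atTop (𝓝 c) :=
    Tendsto.comp (g := fun x => f x / tail F x) hf (tendsto_id.const_mul_atTop ht)
  refine (h1.mul (hF.tendsto_tail_ratio ht)).congr fun x => ?_
  have := hF.tail_pos (t * x)
  field_simp

theorem TailEquiv.eventually_le [IsFiniteMeasure F] (hF : IsRegularlyVarying F α)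
    {f : ℝ → ℝ} {c : ℝ} (hf : TailEquiv f c (tail F)) {b : ℝ} (hb : c < b) :
    ∀ᶠ x in atTop, f x ≤ b * tail F x := by
  filter_upwards [(show Tendsto _ _ _ from hf).eventually_lt_const hb] with x hx
  have := hF.tail_pos x
  exact ((div_lt_iff₀ this).1 hx).le

theorem TailEquiv.nonneg {f g : ℝ → ℝ} {c : ℝ} (hf : TailEquiv f c g) (h0 : ∀ x, 0 ≤ f x)
    (h1 : ∀ x, 0 ≤ g x) : 0 ≤ c :=
  ge_of_tendsto' hf fun x => div_nonneg (h0 x) (h1 x)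

/-- Halving brings any point down to the window [a, 2a]. Estimates on the doubling ratio of a
regularly varying function thereby become global bounds, in place of Karamata or Potter theorems. -/
theorem doubling_induction {Q : ℝ → Prop} {a : ℝ} (ha : 0 < a)
    (h0 : ∀ y, a ≤ y → y ≤ 2 * a → Q y) (hs : ∀ y, a ≤ y → Q y → Q (2 * y)) :
    ∀ y, a ≤ y → Q y := by
  have key : ∀ n : ℕ, ∀ y, a ≤ y → y ≤ 2 ^ n * (2 * a) → Q y := by
    intro n
    induction n with
    | zero => intro y h1 h2; exact h0 y h1 (by simpa using h2)
    | succ n ih =>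
      intro y h1 h2
      by_cases h : y ≤ 2 * a
      · exact h0 y h1 h
      · have := hs (y / 2) (by linarith) (ih (y / 2) (by linarith) (by rw [pow_succ] at h2; linarith))
        rwa [mul_div_cancel₀ y two_ne_zero] at this
  intro y hy
  obtain ⟨n, hn⟩ := pow_unbounded_of_one_lt (y / (2 * a)) one_lt_two
  exact key n y hy ((div_le_iff₀ (by linarith)).1 hn.le)

/-- A regularly varying tail of index `α` decays at most polynomially. -/
theorem IsRegularlyVarying.exists_rpow_le_tail [IsFiniteMeasure F] (hF : IsRegularlyVarying F α) :
    ∃ b > 0, ∀ᶠ x in atTop, b * x ^ (-(α + 1)) ≤ tail F x := by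
  -- The doubling ratio tends to 2^(-α), so far out each doubling costs at most the larger loss
  -- 2^(-(α+1)).
  have h2 : (2 : ℝ) ^ (-(α + 1)) < 2 ^ (-α) :=
    Real.rpow_lt_rpow_of_exponent_lt one_lt_two (by linarith)
  obtain ⟨a, ha⟩ := eventually_atTop.1
    (((hF.tendsto_tail_ratio two_pos).eventually_const_lt h2).and (eventually_gt_atTop 0))
  have ha0 : 0 < a := (ha a le_rfl).2
  have hp := hF.tail_pos (2 * a)
  have hap : 0 < a ^ (-(α + 1)) := Real.rpow_pos_of_pos ha0 _
  refine ⟨tail F (2 * a) / a ^ (-(α + 1)), by positivity, eventually_atTop.2 ⟨a, ?_⟩⟩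
  refine doubling_induction ha0 ?_ ?_
  · intro y h1 h3
    refine le_trans ?_ (tail_antitone F h3)
    rw [div_mul_eq_mul_div, div_le_iff₀ hap]
    exact mul_le_mul_of_nonneg_left
      (Real.rpow_le_rpow_of_nonpos ha0 h1 (by linarith [hF.1])) hp.le
  · intro y h1 h3
    have hy : 0 < y := ha0.trans_le h1
    have h4 := ((lt_div_iff₀ (hF.tail_pos y)).1 (ha y h1).1).le
    refine le_trans ?_ h4
    rw [Real.mul_rpow two_pos.le hy.le, mul_left_comm]
    exact mul_le_mul_of_nonneg_left h3 (Real.rpow_pos_of_pos two_pos _).le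

/-- The gap between r and α absorbs the slowly varying factor: far out each doubling shrinks the
tail by at least the factor 2^(-r). -/
theorem IsRegularlyVarying.exists_tail_le_rpow [IsFiniteMeasure F] (hF : IsRegularlyVarying F α)
    {r : ℝ} (hr0 : 0 ≤ r) (hr : r < α) :
    ∃ b > 0, ∀ᶠ x in atTop, tail F x ≤ b * x ^ (-r) := by
  have h2 : (2 : ℝ) ^ (-α) < 2 ^ (-r) :=
    Real.rpow_lt_rpow_of_exponent_lt one_lt_two (by linarith)
  obtain ⟨a, ha⟩ := eventually_atTop.1
    (((hF.tendsto_tail_ratio two_pos).eventually_lt_const h2).and (eventually_gt_atTop 0))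
  have ha0 : 0 < a := (ha a le_rfl).2
  have hp := hF.tail_pos a
  have hap : 0 < (2 * a) ^ (-r) := Real.rpow_pos_of_pos (by linarith) _
  refine ⟨tail F a / (2 * a) ^ (-r), by positivity, eventually_atTop.2 ⟨a, ?_⟩⟩
  refine doubling_induction ha0 ?_ ?_
  · intro y h1 h3
    refine (tail_antitone F h1).trans ?_
    rw [div_mul_eq_mul_div, le_div_iff₀ hap]
    exact mul_le_mul_of_nonneg_left
      (Real.rpow_le_rpow_of_nonpos (ha0.trans_le h1) h3 (by linarith)) hp.le
  · intro y h1 h3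
    have hy : 0 < y := ha0.trans_le h1
    have h4 := ((div_lt_iff₀ (hF.tail_pos y)).1 (ha y h1).1).le
    refine h4.trans ?_
    rw [Real.mul_rpow two_pos.le hy.le, mul_left_comm]
    exact mul_le_mul_of_nonneg_left h3 (Real.rpow_pos_of_pos two_pos _).le

end Tail

/-! ### Truncated second moments -/

section TruncatedMoment

/-- The second moment of a distribution, restricted to `[0, y]`. -/
def truncSq (H : Measure ℝ) (y : ℝ) : ℝ := ∫ z in Set.Icc 0 y, z ^ 2 ∂H

variable (H : Measure ℝ) [IsProbabilityMeasure H]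

theorem integrableOn_sq_Icc (a y : ℝ) : IntegrableOn (fun z : ℝ => z ^ 2) (Set.Icc a y) H :=
  (continuous_pow 2).continuousOn.integrableOn_compact isCompact_Icc

theorem truncSq_le_sq (y : ℝ) : truncSq H y ≤ y ^ 2 := by
  have h : truncSq H y ≤ ∫ _ in Set.Icc 0 y, y ^ 2 ∂H :=
    setIntegral_mono_on (integrableOn_sq_Icc H 0 y) (integrable_const _) measurableSet_Icc
      fun z hz => pow_le_pow_left₀ hz.1 hz.2 2
  refine h.trans ?_
  rw [setIntegral_const, smul_eq_mul]
  exact mul_le_of_le_one_left (sq_nonneg y) measureReal_le_one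

theorem truncSq_two_mul_le {y : ℝ} (hy : 0 ≤ y) :
    truncSq H (2 * y) ≤ truncSq H y + 4 * y ^ 2 * tail H y := by
  have hu : Set.Icc 0 (2 * y) = Set.Icc 0 y ∪ Set.Ioc y (2 * y) :=
    (Set.Icc_union_Ioc_eq_Icc hy (by linarith)).symm
  have hd : Disjoint (Set.Icc 0 y) (Set.Ioc y (2 * y)) := by
    rw [Set.disjoint_left]
    intro z h1 h2
    exact absurd h2.1 (not_lt.2 h1.2)
  have hi : IntegrableOn (fun z : ℝ => z ^ 2) (Set.Ioc y (2 * y)) H :=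
    (integrableOn_sq_Icc H y (2 * y)).mono_set Set.Ioc_subset_Icc_self
  unfold truncSq
  rw [hu, setIntegral_union hd measurableSet_Ioc (integrableOn_sq_Icc H 0 y) hi]
  gcongr
  have h : ∫ z in Set.Ioc y (2 * y), z ^ 2 ∂H ≤ ∫ _ in Set.Ioc y (2 * y), (2 * y) ^ 2 ∂H :=
    setIntegral_mono_on hi (integrable_const _) measurableSet_Ioc
      fun z hz => pow_le_pow_left₀ (hy.trans hz.1.le) hz.2 2
  refine h.trans ?_
  rw [setIntegral_const, smul_eq_mul]
  have : H.real (Set.Ioc y (2 * y)) ≤ tail H y := measureReal_mono Set.Ioc_subset_Ioi_self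
  nlinarith [sq_nonneg y]

/-- A bound for the truncated second moment by a function which grows at least geometrically
along doublings and dominates `y ^ 2 * tail H y`. -/
theorem exists_truncSq_le {K : ℝ → ℝ} {a C ρ k : ℝ} (ha : 0 < a) (hρ : 1 < ρ) (hC : 0 ≤ C)
    (hk : 0 < k) (hK0 : ∀ y, a ≤ y → y ≤ 2 * a → k ≤ K y)
    (hK : ∀ y, a ≤ y → ρ * K y ≤ K (2 * y))
    (hH : ∀ y, a ≤ y → y ^ 2 * tail H y ≤ C * K y) :
    ∃ B > 0, ∀ y, a ≤ y → truncSq H y ≤ B * K y := by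
  -- The first summand of B covers the window [a, 2a]; the second gives B + 4C ≤ Bρ, which closes
  -- the doubling step.
  set B := 4 * a ^ 2 / k + 4 * C / (ρ - 1) with hB
  have hρ' : 0 < ρ - 1 := by linarith
  have hBpos : 0 < B := by positivity
  have hB1 : 4 * a ^ 2 ≤ B * k := by
    have h1 : 4 * a ^ 2 / k * k = 4 * a ^ 2 := div_mul_cancel₀ _ hk.ne'
    have h2 : 0 ≤ 4 * C / (ρ - 1) * k := by positivity
    rw [hB, add_mul]
    linarith
  have hB2 : B + 4 * C ≤ B * ρ := by
    have h1 : 4 * C / (ρ - 1) * (ρ - 1) = 4 * C := div_mul_cancel₀ _ hρ'.ne'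
    have h2 : 0 ≤ 4 * a ^ 2 / k * (ρ - 1) := by positivity
    have h3 : B * (ρ - 1) = 4 * a ^ 2 / k * (ρ - 1) + 4 * C / (ρ - 1) * (ρ - 1) := by
      rw [hB, add_mul]
    linarith
  have key : ∀ y, a ≤ y → 0 ≤ K y ∧ truncSq H y ≤ B * K y := by
    refine doubling_induction ha ?_ ?_
    · intro y h1 h2
      have h3 := hK0 y h1 h2
      refine ⟨hk.le.trans h3, ?_⟩
      calc truncSq H y ≤ y ^ 2 := truncSq_le_sq H y
        _ ≤ (2 * a) ^ 2 := pow_le_pow_left₀ (ha.le.trans h1) h2 2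
        _ = 4 * a ^ 2 := by ring
        _ ≤ B * k := hB1
        _ ≤ B * K y := by gcongr
    · rintro y h1 ⟨h2, h3⟩
      have h4 := hK y h1
      refine ⟨le_trans (by positivity) h4, ?_⟩
      calc truncSq H (2 * y) ≤ truncSq H y + 4 * y ^ 2 * tail H y :=
            truncSq_two_mul_le H (ha.le.trans h1)
        _ ≤ B * K y + 4 * (C * K y) := by linarith [hH y h1]
        _ = (B + 4 * C) * K y := by ring
        _ ≤ B * ρ * K y := by gcongr
        _ = B * (ρ * K y) := by ring
        _ ≤ B * K (2 * y) := by gcongr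
  exact ⟨B, hBpos, fun y hy => (key y hy).2⟩

end TruncatedMoment

/-! ### An exponential inequality for truncated sums -/

section Exponential

/-- Compare the exponential series of u and v from the quadratic term on: u^(n+2) ≤ (u/v)^2 v^(n+2)
since u ≤ v. -/
theorem exp_sub_le_sq_mul {u v : ℝ} (hu : 0 ≤ u) (huv : u ≤ v) (hv : 0 < v) :
    Real.exp u ≤ 1 + u + (u / v) ^ 2 * Real.exp v := by
  have hsum : ∀ x : ℝ, HasSum (fun n : ℕ => x ^ n / n.factorial) (Real.exp x) := fun x => by
    rw [Real.exp_eq_exp_ℝ]; exact NormedSpace.expSeries_div_hasSum_exp x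
  have h1 := (hasSum_nat_add_iff' 2).2 (hsum u)
  have h2 := ((hasSum_nat_add_iff' 2).2 (hsum v)).mul_left ((u / v) ^ 2)
  have h3 := hasSum_le (fun n => ?_) h1 h2
  · simp only [Finset.sum_range_succ, Finset.sum_range_zero] at h3
    norm_num at h3
    have : 0 ≤ (u / v) ^ 2 * (1 + v) := by positivity
    rw [← sub_sub, mul_sub] at h3
    linarith
  · have hle : u ^ n ≤ v ^ n := pow_le_pow_left₀ hu huv n
    rw [← mul_div_assoc]
    gcongr
    have : (u / v) ^ 2 * v ^ (n + 2) = u ^ 2 * v ^ n := by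
      field_simp
      ring
    rw [this, pow_add, mul_comm]
    gcongr

variable {Ω ι : Type*} [MeasurableSpace Ω] {P : Measure Ω} [IsProbabilityMeasure P]

/-- Integrate the preceding inequality with u = sX and v = sy, then use 1 + a ≤ exp a. -/
theorem mgf_le_of_mem_Icc {X : Ω → ℝ} (hX : Measurable X) {y s : ℝ} (hy : 0 < y) (hs : 0 < s)
    (hXy : ∀ ω, X ω ∈ Set.Icc 0 y) :
    mgf X P s ≤ Real.exp (s * ∫ ω, X ω ∂P + Real.exp (s * y) / y ^ 2 * ∫ ω, X ω ^ 2 ∂P) := by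
  have hb : ∀ ω, ‖X ω‖ ≤ y := fun ω => by
    rw [Real.norm_eq_abs, abs_of_nonneg (hXy ω).1]; exact (hXy ω).2
  have i1 : Integrable X P := .of_bound hX.aestronglyMeasurable y (.of_forall hb)
  have i2 : Integrable (fun ω => X ω ^ 2) P :=
    .of_bound (hX.pow_const 2).aestronglyMeasurable (y ^ 2) (.of_forall fun ω => by
      rw [norm_pow]; exact pow_le_pow_left₀ (norm_nonneg _) (hb ω) 2)
  have i3 : Integrable (fun ω => Real.exp (s * X ω)) P :=
    .of_bound (hX.const_mul s).exp.aestronglyMeasurable (Real.exp (s * y)) (.of_forall fun ω => by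
      rw [Real.norm_eq_abs, Real.abs_exp]
      exact Real.exp_le_exp.2 (mul_le_mul_of_nonneg_left (hXy ω).2 hs.le))
  have i4 : Integrable (fun ω => 1 + s * X ω) P := (integrable_const 1).add (i1.const_mul s)
  have h : mgf X P s ≤
      ∫ ω, (1 + s * X ω + Real.exp (s * y) / y ^ 2 * X ω ^ 2) ∂P := by
    refine integral_mono i3 (i4.add (i2.const_mul _)) ?_
    intro ω
    have := exp_sub_le_sq_mul (mul_nonneg hs.le (hXy ω).1)
      (mul_le_mul_of_nonneg_left (hXy ω).2 hs.le) (mul_pos hs hy)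
    refine this.trans (le_of_eq ?_)
    field_simp
  rw [integral_add i4 (i2.const_mul _),
    integral_add (integrable_const 1) (i1.const_mul s), integral_const_mul, integral_const_mul] at h
  simp only [integral_const, probReal_univ, one_smul] at h
  refine h.trans ?_
  rw [add_assoc, add_comm]
  exact Real.add_one_le_exp _

/-- An exponential inequality for sums of independent, bounded, nonnegative variables. -/
theorem measure_sum_ge_le_of_mem_Icc {X : ι → Ω → ℝ} (hind : iIndepFun X P)
    (hX : ∀ i, Measurable (X i)) {y : ℝ} (hy : 0 < y) (hXy : ∀ i ω, X i ω ∈ Set.Icc 0 y)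
    (s : Finset ι) (q : ℕ) {W : ℝ} (hW : 0 < W) (hm : ∑ i ∈ s, ∫ ω, X i ω ∂P ≤ q * y)
    (hv : ∑ i ∈ s, ∫ ω, X i ω ^ 2 ∂P ≤ W) :
    P.real {ω | 2 * q * y ≤ ∑ i ∈ s, X i ω} ≤ Real.exp 1 * (W / y ^ 2) ^ q := by
  by_cases hWy : y ^ 2 ≤ W
  · refine measureReal_le_one.trans ?_
    have h1 : 1 ≤ W / y ^ 2 := (one_le_div (by positivity)).2 hWy
    have h2 : (1 : ℝ) ≤ Real.exp 1 := Real.one_le_exp zero_le_one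
    exact one_le_mul_of_one_le_of_one_le h2 (one_le_pow₀ h1)
  push Not at hWy
  have hr : 1 < y ^ 2 / W := (one_lt_div hW).2 hWy
  set v := Real.log (y ^ 2 / W) with hvdef
  have hv0 : 0 < v := Real.log_pos hr
  have hev : Real.exp v = y ^ 2 / W := Real.exp_log (by positivity)
  -- With this t, exp(ty) W / y² = 1, so the second moments cost only a factor e. The means cost at
  -- most exp(qv) and Chernoff's bound gains exp(-2qv), leaving e · exp(-qv).
  set t := v / y with ht
  have ht0 : 0 < t := by positivity
  have hty : t * y = v := div_mul_cancel₀ _ hy.ne'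
  have hmeas : Measurable (∑ i ∈ s, X i) := by
    rw [show (∑ i ∈ s, X i) = fun ω => ∑ i ∈ s, X i ω from by ext; simp]
    exact Finset.measurable_sum s fun i _ => hX i
  have hint : Integrable (fun ω => Real.exp (t * (∑ i ∈ s, X i) ω)) P := by
    refine .of_bound (hmeas.const_mul t).exp.aestronglyMeasurable
      (Real.exp (t * (s.card * y))) (.of_forall fun ω => ?_)
    rw [Real.norm_eq_abs, Real.abs_exp, Real.exp_le_exp, Finset.sum_apply]
    refine mul_le_mul_of_nonneg_left ?_ ht0.le
    rw [← nsmul_eq_mul]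
    exact Finset.sum_le_card_nsmul _ _ _ fun i _ => (hXy i ω).2
  have h1 := measure_ge_le_exp_mul_mgf (μ := P) (X := ∑ i ∈ s, X i) (2 * q * y) ht0.le hint
  rw [hind.mgf_sum hX] at h1
  have h2 : ∏ i ∈ s, mgf (X i) P t ≤ Real.exp (t * (q * y) + Real.exp v / y ^ 2 * W) := by
    calc ∏ i ∈ s, mgf (X i) P t
        ≤ ∏ i ∈ s, Real.exp (t * ∫ ω, X i ω ∂P + Real.exp v / y ^ 2 * ∫ ω, X i ω ^ 2 ∂P) := by
          refine Finset.prod_le_prod (fun i _ => mgf_nonneg) fun i _ => ?_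
          have := mgf_le_of_mem_Icc (P := P) (hX i) hy ht0 (hXy i)
          rwa [hty] at this
      _ = Real.exp (t * ∑ i ∈ s, ∫ ω, X i ω ∂P +
            Real.exp v / y ^ 2 * ∑ i ∈ s, ∫ ω, X i ω ^ 2 ∂P) := by
          rw [← Real.exp_sum, Finset.sum_add_distrib, Finset.mul_sum, Finset.mul_sum]
      _ ≤ _ := by gcongr
  simp only [Finset.sum_apply] at h1
  refine h1.trans ((mul_le_mul_of_nonneg_left h2 (Real.exp_pos _).le).trans (le_of_eq ?_))
  have hWy2 : W / y ^ 2 = Real.exp (-v) := by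
    rw [Real.exp_neg, hev, inv_div]
  rw [hWy2, ← Real.exp_nat_mul, ← Real.exp_add, ← Real.exp_add]
  congr 1
  have : Real.exp v / y ^ 2 * W = 1 := by
    rw [hev]; field_simp
  rw [this, ← hty]
  ring

end Exponential

/-! ### A tail bound uniform in the number of summands -/

section UniformBound

variable {F : Measure ℝ} {α : ℝ}

theorem IsRegularlyVarying.exists_tail_le_tail_mul [IsFiniteMeasure F]
    (hF : IsRegularlyVarying F α) {t : ℝ} (ht : 0 < t) :
    ∃ D > 0, ∀ᶠ x in atTop, tail F x ≤ D * tail F (t * x) := by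
  have h0 : 0 < t ^ (-α) := Real.rpow_pos_of_pos ht _
  refine ⟨2 * (t ^ (-α))⁻¹, by positivity, ?_⟩
  filter_upwards [(hF.tendsto_tail_ratio ht).eventually_const_lt (half_lt_self h0)] with x hx
  rw [lt_div_iff₀ (hF.tail_pos x)] at hx
  have : tail F x = 2 * (t ^ (-α))⁻¹ * (t ^ (-α) / 2 * tail F x) := by field_simp
  rw [this]
  gcongr

/-- A function which controls truncated second moments of distributions whose tail is at most of
the order of `tail F`, and which is small enough for the exponential inequality. -/
theorem IsRegularlyVarying.exists_control [IsFiniteMeasure F] (hF : IsRegularlyVarying F α) :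
    ∃ (K : ℝ → ℝ) (q : ℕ) (ρ C D : ℝ), 1 ≤ q ∧ 1 < ρ ∧ 0 < C ∧ 0 < D ∧
      (∀ᶠ a in atTop, ∃ k > 0, ∀ y, a ≤ y → y ≤ 2 * a → k ≤ K y) ∧
      (∀ᶠ y in atTop, 0 < K y ∧ ρ * K y ≤ K (2 * y) ∧ y ^ 2 * tail F y ≤ C * K y ∧
        ∀ k, 1 ≤ k → k ≤ y → (k * K y / y ^ 2) ^ q ≤ D * (k * tail F y)) := by
  -- For α < 2 the function y² · tail is itself the control: its doubling ratio tends to 2^(2-α) >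
  -- 1, which leaves room for ρ = 4r > 1, and q = 1 suffices.
  by_cases hα : α < 2
  · have h2 : (2 : ℝ) ^ (-2 : ℝ) < 2 ^ (-α) :=
      Real.rpow_lt_rpow_of_exponent_lt one_lt_two (by linarith)
    have h4 : (2 : ℝ) ^ (-2 : ℝ) = 1 / 4 := by
      rw [Real.rpow_neg two_pos.le]; norm_num
    rw [h4] at h2
    obtain ⟨r, hr1, hr2⟩ := exists_between h2
    refine ⟨fun y => y ^ 2 * tail F y, 1, 4 * r, 1, 1, le_rfl, by linarith, one_pos, one_pos,
      ?_, ?_⟩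
    · filter_upwards [eventually_gt_atTop 0] with a ha
      refine ⟨a ^ 2 * tail F (2 * a), mul_pos (by positivity) (hF.tail_pos _), fun y h1 h3 => ?_⟩
      exact mul_le_mul (pow_le_pow_left₀ ha.le h1 2) (tail_antitone F h3) (tail_nonneg _ _)
        (sq_nonneg _)
    · filter_upwards [eventually_gt_atTop 0,
        (hF.tendsto_tail_ratio two_pos).eventually_const_lt hr2] with y hy hry
      rw [lt_div_iff₀ (hF.tail_pos y)] at hry
      refine ⟨mul_pos (by positivity) (hF.tail_pos _), ?_, by simp, fun k _ _ => ?_⟩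
      · nlinarith [sq_nonneg y]
      · rw [pow_one, one_mul]
        refine le_of_eq ?_
        field_simp
  -- For α ≥ 2, y² · tail need not grow, so y^(1/2) replaces it; it dominates because 3/2 < α. With
  -- k ≤ y, the q-th power is at most k · y^(-1-q/2), and q ≥ 2α brings this below k · y^(-(α+1)),
  -- hence below a multiple of k · tail.
  · push Not at hα
    obtain ⟨b, hb, hbF⟩ := hF.exists_rpow_le_tail
    obtain ⟨C, hC, hCF⟩ := hF.exists_tail_le_rpow (r := 3 / 2) (by norm_num) (by linarith)
    obtain ⟨q, hq⟩ := exists_nat_ge (2 * α)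
    have hq1 : 1 ≤ q := by
      have : (1 : ℝ) ≤ q := by linarith
      exact_mod_cast this
    refine ⟨fun y => y ^ (1 / 2 : ℝ), q, 2 ^ (1 / 2 : ℝ), C, 1 / b, hq1,
      Real.one_lt_rpow one_lt_two (by norm_num), hC, by positivity, ?_, ?_⟩
    · filter_upwards [eventually_gt_atTop 0] with a ha
      exact ⟨a ^ (1 / 2 : ℝ), Real.rpow_pos_of_pos ha _,
        fun y h1 _ => Real.rpow_le_rpow ha.le h1 (by norm_num)⟩
    · filter_upwards [eventually_ge_atTop 1, hbF, hCF] with y hy1 hby hCy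
      have hy : 0 < y := by linarith
      refine ⟨Real.rpow_pos_of_pos hy _, (Real.mul_rpow two_pos.le hy.le).ge, ?_, ?_⟩
      · calc y ^ 2 * tail F y ≤ y ^ 2 * (C * y ^ (-(3 / 2) : ℝ)) := by gcongr
          _ = C * (y ^ (2 : ℝ) * y ^ (-(3 / 2) : ℝ)) := by
            rw [Real.rpow_two]; ring
          _ = C * y ^ (1 / 2 : ℝ) := by
            rw [← Real.rpow_add hy]; norm_num
      · intro k hk1 hky
        have e1 : k * y ^ (1 / 2 : ℝ) / y ^ 2 = k * y ^ (-(3 / 2) : ℝ) := by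
          rw [mul_div_assoc, ← Real.rpow_two, ← Real.rpow_sub hy]; norm_num
        have e2 : k ^ q ≤ k * y ^ ((q : ℝ) - 1) := by
          obtain ⟨n, rfl⟩ := Nat.exists_eq_add_of_le' hq1
          rw [pow_succ, mul_comm, Nat.cast_add, Nat.cast_one, add_sub_cancel_right,
            Real.rpow_natCast]
          gcongr
        calc (k * y ^ (1 / 2 : ℝ) / y ^ 2) ^ q
            = k ^ q * y ^ (-(3 / 2) * q : ℝ) := by
              rw [e1, mul_pow, Real.rpow_mul hy.le, Real.rpow_natCast]
          _ ≤ k * y ^ ((q : ℝ) - 1) * y ^ (-(3 / 2) * q : ℝ) := by gcongr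
          _ = k * y ^ ((q : ℝ) - 1 + -(3 / 2) * q) := by rw [mul_assoc, ← Real.rpow_add hy]
          _ ≤ k * y ^ (-(α + 1)) := by
              gcongr
              linarith
          _ = 1 / b * (k * (b * y ^ (-(α + 1)))) := by field_simp
          _ ≤ 1 / b * (k * tail F y) := by gcongr

variable {Ω ι κ : Type*} [MeasurableSpace Ω] {P : Measure Ω} [IsProbabilityMeasure P] [Fintype κ]

/-- The probability that a sum of independent variables exceeds `x` is at most of the order of the
number of summands times the reference tail, uniformly as long as the number of summands is at
most a small multiple of `x`. -/
theorem exists_measure_sum_gt_le [IsFiniteMeasure F] (hF : IsRegularlyVarying F α)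
    {H : κ → Measure ℝ} [∀ j, IsProbabilityMeasure (H j)]
    (hmean : ∀ j, Integrable (fun z : ℝ => z) (H j)) {c : κ → ℝ}
    (hc : ∀ j, TailEquiv (tail (H j)) (c j) (tail F))
    {Z : ι → Ω → ℝ} (hZ : ∀ i, Measurable (Z i)) (hind : iIndepFun Z P) {g : ι → κ}
    (hlaw : ∀ i, P.map (Z i) = H (g i)) :
    ∃ C > 0, ∃ ε > 0, ∀ᶠ x in atTop, ∀ s : Finset ι, (s.card : ℝ) ≤ ε * x →
      P.real {ω | x < ∑ i ∈ s, Z i ω} ≤ C * s.card * tail F x := by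
  obtain ⟨K, q, ρ, C₁, D, hq, hρ, hC₁, hD, hK0, hK⟩ := hF.exists_control
  have hcn : ∀ j, 0 ≤ c j := fun j => (hc j).nonneg (tail_nonneg _) (tail_nonneg _)
  set C₀ := ∑ j, (c j + 1) with hC₀
  have hC₀0 : 0 ≤ C₀ := Finset.sum_nonneg fun j _ => by linarith [hcn j]
  have htail : ∀ᶠ y in atTop, ∀ j, tail (H j) y ≤ C₀ * tail F y := by
    rw [eventually_all]
    intro j
    filter_upwards [(hc j).eventually_le hF (lt_add_one _)] with y hy
    refine hy.trans (mul_le_mul_of_nonneg_right ?_ (tail_nonneg _ _))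
    exact Finset.single_le_sum (f := fun j => c j + 1) (fun j _ => by linarith [hcn j])
      (Finset.mem_univ j)
  have htrunc : ∃ B > 0, ∀ᶠ y in atTop, ∀ j, truncSq (H j) y ≤ B * K y := by
    obtain ⟨a', ha'⟩ := eventually_atTop.1 (hK.and htail)
    obtain ⟨a, ⟨k, hk, hak⟩, ha0, haa'⟩ :=
      (hK0.and ((eventually_gt_atTop 0).and (eventually_ge_atTop a'))).exists
    have hB : ∀ j, ∃ B > 0, ∀ y, a ≤ y → truncSq (H j) y ≤ B * K y := fun j =>
      exists_truncSq_le (H j) ha0 hρ (by positivity : 0 ≤ C₀ * C₁) hk hak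
        (fun y hy => (ha' y (haa'.trans hy)).1.2.1) fun y hy => by
          have h1 := ha' y (haa'.trans hy)
          calc y ^ 2 * tail (H j) y ≤ y ^ 2 * (C₀ * tail F y) := by gcongr; exact h1.2 j
            _ = C₀ * (y ^ 2 * tail F y) := by ring
            _ ≤ C₀ * (C₁ * K y) := mul_le_mul_of_nonneg_left h1.1.2.2.1 hC₀0
            _ = C₀ * C₁ * K y := by ring
    choose B hB0 hB using hB
    refine ⟨∑ j, B j + 1, by
      have := Finset.sum_nonneg fun j (_ : j ∈ Finset.univ) => (hB0 j).le
      linarith, eventually_atTop.2 ⟨a, fun y hy j => (hB j y hy).trans ?_⟩⟩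
    have h1 := Finset.single_le_sum (fun j _ => (hB0 j).le) (Finset.mem_univ j)
    have h2 := (ha' y (haa'.trans hy)).1.1
    gcongr
    linarith
  obtain ⟨B, hB, hBK⟩ := htrunc
  have hq0 : (0 : ℝ) < q := by exact_mod_cast hq
  obtain ⟨D', hD', hDF⟩ := hF.exists_tail_le_tail_mul (t := 2 * q) (by positivity)
  set m := ∑ j, ∫ z, |z| ∂(H j) + 1 with hm
  have hm0 : 0 < m := by
    have := Finset.sum_nonneg fun j (_ : j ∈ Finset.univ) =>
      integral_nonneg (μ := H j) (f := fun z : ℝ => |z|) fun z => abs_nonneg z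
    linarith
  have hmj : ∀ j, ∫ z, |z| ∂(H j) ≤ m := fun j => by
    have := Finset.single_le_sum (f := fun j => ∫ z, |z| ∂(H j))
      (fun j _ => integral_nonneg fun z => abs_nonneg z) (Finset.mem_univ j)
    linarith
  -- The first bound on ε keeps the sum of the truncated means below qy = x/2; the second keeps the
  -- number of summands below y, as the control function requires.
  refine ⟨C₀ * D' + Real.exp 1 * B ^ q * D * D', by positivity,
    min (1 / (2 * m)) (1 / (2 * q)), by positivity, ?_⟩
  have hscale : Tendsto (fun x : ℝ => x / (2 * q)) atTop atTop :=
    tendsto_id.atTop_div_const (by positivity)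
  filter_upwards [eventually_gt_atTop 0, hscale.eventually hK, hscale.eventually htail,
    hscale.eventually hBK, hscale.eventually hDF] with x hx hKx htx hBx hDx s hs
  rcases s.eq_empty_or_nonempty with rfl | hne
  · simp [not_lt.2 hx.le]
  have hk1 : (1 : ℝ) ≤ s.card := by exact_mod_cast hne.card_pos
  set y := x / (2 * q) with hy
  have hxy : 2 * q * y = x := by rw [hy]; field_simp
  have hy0 : 0 < y := by positivity
  rw [hxy] at hDx
  have hky : (s.card : ℝ) ≤ y := by
    refine hs.trans ((mul_le_mul_of_nonneg_right (min_le_right _ _) hx.le).trans (le_of_eq ?_))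
    rw [hy]; field_simp
  have hkm : (s.card : ℝ) * m ≤ q * y := by
    have h1 := hs.trans (mul_le_mul_of_nonneg_right (min_le_left _ _) hx.le)
    have h2 : 1 / (2 * m) * x * m = q * y := by rw [hy]; field_simp
    rw [← h2]
    gcongr
  -- Negative values are replaced by 0, which can only increase the sum; values above y are treated
  -- separately as jumps.
  set φ : ℝ → ℝ := (Set.Icc 0 y).indicator id with hφ
  have hφm : Measurable φ := measurable_id.indicator measurableSet_Icc
  have hφy : ∀ z, φ z ∈ Set.Icc 0 y := fun z => by
    by_cases h : z ∈ Set.Icc 0 y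
    · rw [hφ, Set.indicator_of_mem h]; exact h
    · rw [hφ, Set.indicator_of_notMem h]; exact ⟨le_rfl, hy0.le⟩
  have hφ1 : ∀ i, ∫ ω, φ (Z i ω) ∂P ≤ m := fun i => by
    rw [← integral_map (hZ i).aemeasurable hφm.aestronglyMeasurable, hlaw i]
    refine le_trans (integral_mono_of_nonneg (.of_forall fun z => (hφy z).1) (hmean _).abs
      (.of_forall fun z => ?_)) (hmj (g i))
    by_cases h : z ∈ Set.Icc 0 y
    · simpa [hφ, Set.indicator_of_mem h] using le_abs_self z
    · simp [hφ, Set.indicator_of_notMem h]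
  have hφ2 : ∀ i, ∫ ω, φ (Z i ω) ^ 2 ∂P ≤ B * K y := fun i => by
    rw [← integral_map (f := fun z => φ z ^ 2) (hZ i).aemeasurable
      (hφm.pow_const 2).aestronglyMeasurable, hlaw i]
    refine le_trans (le_of_eq ?_) (hBx (g i))
    rw [truncSq, ← integral_indicator measurableSet_Icc]
    congr 1
    ext z
    by_cases h : z ∈ Set.Icc 0 y
    · simp [hφ, Set.indicator_of_mem h]
    · simp [hφ, Set.indicator_of_notMem h]
  have hsub : {ω | x < ∑ i ∈ s, Z i ω} ⊆
      (⋃ i ∈ s, {ω | y < Z i ω}) ∪ {ω | 2 * q * y ≤ ∑ i ∈ s, φ (Z i ω)} := by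
    intro ω hω
    by_cases h : ∃ i ∈ s, y < Z i ω
    · obtain ⟨i, hi, hiy⟩ := h
      exact Or.inl (Set.mem_biUnion hi hiy)
    · push Not at h
      refine Or.inr ?_
      rw [Set.mem_ofPred_eq, hxy]
      refine (le_of_lt hω).trans (Finset.sum_le_sum fun i hi => ?_)
      by_cases h0 : 0 ≤ Z i ω
      · rw [hφ, Set.indicator_of_mem (show Z i ω ∈ Set.Icc 0 y from ⟨h0, h i hi⟩), id]
      · exact (not_le.1 h0).le.trans (hφy _).1
  have hV0 : 0 < s.card * (B * K y) := mul_pos (by linarith) (mul_pos hB hKx.1)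
  have hexp := measure_sum_ge_le_of_mem_Icc (P := P) (X := fun i ω => φ (Z i ω))
    (hind.comp (fun _ => φ) fun _ => hφm) (fun i => hφm.comp (hZ i)) hy0
    (fun i ω => hφy (Z i ω)) s q hV0
    ((Finset.sum_le_card_nsmul s _ m fun i _ => hφ1 i).trans (by rwa [nsmul_eq_mul]))
    ((Finset.sum_le_card_nsmul s _ (B * K y) fun i _ => hφ2 i).trans (by rw [nsmul_eq_mul]))
  have hjump : P.real (⋃ i ∈ s, {ω | y < Z i ω}) ≤ s.card * (C₀ * tail F y) := by
    refine (measureReal_biUnion_finset_le s _).trans ?_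
    rw [← nsmul_eq_mul]
    refine Finset.sum_le_card_nsmul s _ _ fun i _ => ?_
    refine le_trans (le_of_eq ?_) (htx (g i))
    rw [tail, ← hlaw i, map_measureReal_apply (hZ i) measurableSet_Ioi]
    rfl
  have hpow := hKx.2.2.2 s.card hk1 hky
  calc P.real {ω | x < ∑ i ∈ s, Z i ω}
      ≤ s.card * (C₀ * tail F y) + Real.exp 1 * (s.card * (B * K y) / y ^ 2) ^ q :=
        (measureReal_mono hsub).trans ((measureReal_union_le _ _).trans (add_le_add hjump hexp))
    _ = s.card * (C₀ * tail F y) + Real.exp 1 * B ^ q * (s.card * K y / y ^ 2) ^ q := by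
        rw [mul_assoc (Real.exp 1), ← mul_pow]; congr 3; ring
    _ ≤ s.card * (C₀ * tail F y) + Real.exp 1 * B ^ q * (D * (s.card * tail F y)) := by gcongr
    _ = (C₀ + Real.exp 1 * B ^ q * D) * s.card * tail F y := by ring
    _ ≤ (C₀ + Real.exp 1 * B ^ q * D) * s.card * (D' * tail F x) := by gcongr
    _ = _ := by ring

end UniformBound

/-! ### Sums of a fixed number of independent variables -/

section FixedSum

variable {F : Measure ℝ} {α : ℝ} {Ω ι : Type*} [MeasurableSpace Ω] {P : Measure Ω}
  [IsProbabilityMeasure P]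

theorem tendsto_measureReal_gt_atTop {X : Ω → ℝ} (hX : Measurable X) :
    Tendsto (fun x : ℝ => P.real {ω | x < X ω}) atTop (𝓝 0) := by
  have h := tendsto_measure_iInter_atTop (μ := P) (s := fun x : ℝ => {ω | x < X ω})
    (fun x => (measurableSet_lt measurable_const hX).nullMeasurableSet)
    (fun x y hxy ω hω => lt_of_le_of_lt hxy hω) ⟨0, measure_ne_top _ _⟩
  have h0 : ⋂ x : ℝ, {ω | x < X ω} = ∅ := by
    ext ω
    simp only [Set.mem_iInter, Set.mem_ofPred_eq, Set.mem_empty_iff_false, iff_false, not_forall]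
    exact ⟨X ω, lt_irrefl _⟩
  rw [h0, measure_empty] at h
  exact (ENNReal.tendsto_toReal ENNReal.zero_ne_top).comp h

/-- The tail of a sum of two independent variables. -/
theorem TailEquiv.add_of_indepFun [IsFiniteMeasure F] (hF : IsRegularlyVarying F α)
    {X Y : Ω → ℝ} (hX : Measurable X) (hY : Measurable Y) (hXY : IndepFun X Y P) {a b : ℝ}
    (ha : TailEquiv (fun x => P.real {ω | x < X ω}) a (tail F))
    (hb : TailEquiv (fun x => P.real {ω | x < Y ω}) b (tail F)) :
    TailEquiv (fun x => P.real {ω | x < X ω + Y ω}) (a + b) (tail F) := by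
  have hXm : ∀ x, MeasurableSet {ω | x < X ω} := fun x => measurableSet_lt measurable_const hX
  have hYm : ∀ x, MeasurableSet {ω | x < Y ω} := fun x => measurableSet_lt measurable_const hY
  have hprod : ∀ x y : ℝ, P.real ({ω | x < X ω} ∩ {ω | y < Y ω}) =
      P.real {ω | x < X ω} * P.real {ω | y < Y ω} := fun x y => by
    have := hXY.measure_inter_preimage_eq_mul (Set.Ioi x) (Set.Ioi y) measurableSet_Ioi
      measurableSet_Ioi
    simp only [Measure.real]
    rw [← ENNReal.toReal_mul]
    exact congrArg _ this
  have htop : ∀ {t : ℝ}, 0 < t → Tendsto (fun x : ℝ => t * x) atTop atTop := fun ht =>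
    tendsto_id.const_mul_atTop ht
  -- If neither variable exceeds (1-δ)x, both must exceed δx; by independence that event is a
  -- product, negligible against the reference tail.
  have hupper : ∀ δ x : ℝ, P.real {ω | x < X ω + Y ω} ≤
      P.real {ω | (1 - δ) * x < X ω} + P.real {ω | (1 - δ) * x < Y ω} +
        P.real {ω | δ * x < X ω} * P.real {ω | δ * x < Y ω} := by
    intro δ x
    rw [← hprod]
    refine (measureReal_mono (?_ : _ ⊆ ({ω | (1 - δ) * x < X ω} ∪ {ω | (1 - δ) * x < Y ω}) ∪
      ({ω | δ * x < X ω} ∩ {ω | δ * x < Y ω}))).trans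
      ((measureReal_union_le _ _).trans (add_le_add_left (measureReal_union_le _ _) _))
    intro ω (hω : x < X ω + Y ω)
    by_contra h
    simp only [Set.mem_union, Set.mem_inter_iff, Set.mem_ofPred_eq, not_or, not_lt, not_and] at h
    obtain ⟨⟨h1, h2⟩, h3⟩ := h
    have := h3 (by linarith)
    linarith
  -- One variable is above (1+δ)x and the other does not undo it. The two such events overlap only
  -- when both variables are large, which is subtracted.
  have hlower : ∀ δ : ℝ, 0 < δ → ∀ x : ℝ, 0 < x →
      P.real {ω | (1 + δ) * x < X ω} * P.real {ω | -(δ * x) < Y ω} +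
        P.real {ω | (1 + δ) * x < Y ω} * P.real {ω | -(δ * x) < X ω} -
        P.real {ω | (1 + δ) * x < X ω} * P.real {ω | (1 + δ) * x < Y ω} ≤
      P.real {ω | x < X ω + Y ω} := by
    intro δ hδ x hx
    rw [mul_comm (P.real {ω | (1 + δ) * x < Y ω}), ← hprod, ← hprod, ← hprod, sub_le_iff_le_add,
      ← measureReal_union_add_inter ((hXm _).inter (hYm _))]
    refine add_le_add (measureReal_mono ?_) (measureReal_mono ?_)
    · rintro ω (⟨h1, h2⟩ | ⟨h1, h2⟩) <;> simp only [Set.mem_ofPred_eq] at h1 h2 ⊢ <;> linarith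
    · rintro ω ⟨⟨h1, _⟩, ⟨_, h2⟩⟩
      exact ⟨h1, h2⟩
  have hneg : ∀ {X : Ω → ℝ}, Measurable X → ∀ δ : ℝ, 0 < δ →
      Tendsto (fun x : ℝ => P.real {ω | -(δ * x) < X ω}) atTop (𝓝 1) := by
    intro X hX δ hδ
    have h1 := (tendsto_measureReal_gt_atTop (P := P) hX.neg).comp
      (htop (half_pos hδ))
    have h2 : Tendsto (fun x : ℝ => 1 - P.real {ω | δ / 2 * x < -X ω}) atTop (𝓝 (1 - 0)) :=
      tendsto_const_nhds.sub h1
    rw [sub_zero] at h2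
    refine tendsto_of_tendsto_of_tendsto_of_le_of_le' h2 tendsto_const_nhds ?_
      (.of_forall fun x => measureReal_le_one)
    filter_upwards [eventually_gt_atTop 0] with x hx
    rw [sub_le_iff_le_add]
    have h3 : P.real (Set.univ : Set Ω) ≤
        P.real ({ω | -(δ * x) < X ω} ∪ {ω | δ / 2 * x < -X ω}) := by
      refine measureReal_mono fun ω _ => ?_
      by_cases h : -(δ * x) < X ω
      · exact Or.inl h
      · refine Or.inr ?_
        have := mul_pos hδ hx
        simp only [Set.mem_ofPred_eq]
        linarith
    rw [probReal_univ] at h3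
    exact h3.trans (measureReal_union_le _ _)
  have hcont : ∀ σ : ℝ, Tendsto (fun δ : ℝ => (a + b) * (1 + σ * δ) ^ (-α)) (𝓝[>] 0)
      (𝓝 (a + b)) := by
    intro σ
    have h1 : ContinuousAt (fun δ : ℝ => (a + b) * (1 + σ * δ) ^ (-α)) 0 := by
      refine continuousAt_const.mul (ContinuousAt.rpow_const (by fun_prop) (Or.inl (by simp)))
    have := h1.tendsto
    simp only [mul_zero, add_zero, Real.one_rpow, mul_one] at this
    exact this.mono_left nhdsWithin_le_nhds
  have hdelta : ∀ᶠ δ : ℝ in 𝓝[>] 0, 0 < δ ∧ δ < 1 := by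
    filter_upwards [Ioo_mem_nhdsGT (zero_lt_one' ℝ)] with δ hδ using hδ
  refine tendsto_order.2 ⟨fun l hl => ?_, fun u hu => ?_⟩
  · obtain ⟨δ, h1, hδ, hδ1⟩ := (((hcont 1).eventually_const_lt hl).and hdelta).exists
    rw [one_mul] at h1
    have t1 := ((ha.comp_mul hF (t := 1 + δ) (by linarith)).mul (hneg hY δ hδ)).add
      ((hb.comp_mul hF (t := 1 + δ) (by linarith)).mul (hneg hX δ hδ))
    have t2 := t1.sub ((ha.comp_mul hF (t := 1 + δ) (by linarith)).mul
      ((tendsto_measureReal_gt_atTop (P := P) hY).comp (htop (by linarith : 0 < 1 + δ))))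
    simp only [mul_one, mul_zero, sub_zero, ← add_mul] at t2
    filter_upwards [t2.eventually_const_lt h1, eventually_gt_atTop 0] with x hx hx0
    refine hx.trans_le ?_
    have hp := hF.tail_pos x
    rw [le_div_iff₀ hp]
    refine le_trans (le_of_eq ?_) (hlower δ hδ x hx0)
    simp only [Function.comp]
    field_simp
  · obtain ⟨δ, h1, hδ, hδ1⟩ := (((hcont (-1)).eventually_lt_const hu).and hdelta).exists
    rw [neg_one_mul, ← sub_eq_add_neg] at h1
    have t1 := ((ha.comp_mul hF (t := 1 - δ) (by linarith)).add
      (hb.comp_mul hF (t := 1 - δ) (by linarith))).add ((ha.comp_mul hF hδ).mul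
      ((tendsto_measureReal_gt_atTop (P := P) hY).comp (htop hδ)))
    simp only [mul_zero, add_zero, ← add_mul] at t1
    filter_upwards [t1.eventually_lt_const h1] with x hx
    refine lt_of_le_of_lt ?_ hx
    have hp := hF.tail_pos x
    rw [div_le_iff₀ hp]
    refine (hupper δ x).trans (le_of_eq ?_)
    simp only [Function.comp]
    field_simp

theorem TailEquiv.sum_of_iIndepFun [IsFiniteMeasure F] (hF : IsRegularlyVarying F α)
    {Z : ι → Ω → ℝ} (hZ : ∀ i, Measurable (Z i)) (hind : iIndepFun Z P) {c : ι → ℝ}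
    (hc : ∀ i, TailEquiv (fun x => P.real {ω | x < Z i ω}) (c i) (tail F)) (s : Finset ι) :
    TailEquiv (fun x => P.real {ω | x < ∑ i ∈ s, Z i ω}) (∑ i ∈ s, c i) (tail F) := by
  classical
  induction s using Finset.induction_on with
  | empty =>
    refine tendsto_const_nhds.congr' ?_
    filter_upwards [eventually_gt_atTop 0] with x hx
    simp [not_lt.2 hx.le]
  | insert i s hi ih =>
    have h := hind.indepFun_finsetSum_of_notMem hZ hi
    rw [show (∑ i ∈ s, Z i) = fun ω => ∑ i ∈ s, Z i ω from by ext; simp] at h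
    have := (hc i).add_of_indepFun hF (hZ i) (Finset.measurable_sum s fun i _ => hZ i) h.symm ih
    simpa only [Finset.sum_insert hi] using this

end FixedSum

/-! ### A continuous partition of unity on the line -/

section Tent

/-- Truncation to the unit interval. -/
def clamp (u : ℝ) : ℝ := max 0 (min 1 u)

theorem clamp_mono : Monotone clamp := fun _ _ h => max_le_max le_rfl (min_le_min le_rfl h)

theorem clamp_of_nonpos {u : ℝ} (h : u ≤ 0) : clamp u = 0 :=
  max_eq_left ((min_le_right _ _).trans h)

theorem clamp_of_one_le {u : ℝ} (h : 1 ≤ u) : clamp u = 1 := by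
  rw [clamp, min_eq_left h, max_eq_right zero_le_one]

theorem clamp_nonneg (u : ℝ) : 0 ≤ clamp u := le_max_left _ _

theorem clamp_le_one (u : ℝ) : clamp u ≤ 1 := max_le zero_le_one (min_le_left _ _)

theorem continuous_clamp : Continuous clamp := by unfold clamp; fun_prop

/-- The hat function which is supported in `[i - 1, i + 1]` and equals `1` at `i`. -/
def tent (i : ℕ) (σ : ℝ) : ℝ := clamp (σ + 1 - i) - clamp (σ + 1 - (i + 1 : ℕ))

theorem tent_nonneg (i : ℕ) (σ : ℝ) : 0 ≤ tent i σ :=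
  sub_nonneg.2 (clamp_mono (by push_cast; linarith))

theorem tent_le_one (i : ℕ) (σ : ℝ) : tent i σ ≤ 1 := by
  have := clamp_nonneg (σ + 1 - (i + 1 : ℕ))
  have := clamp_le_one (σ + 1 - i)
  unfold tent
  linarith

theorem lt_of_tent_ne_zero {i : ℕ} {σ : ℝ} (h : tent i σ ≠ 0) : (i : ℝ) - 1 < σ ∧ σ < i + 1 := by
  constructor
  · by_contra! h1
    exact h (by rw [tent, clamp_of_nonpos (by linarith), clamp_of_nonpos (by push_cast; linarith),
      sub_zero])
  · by_contra! h1
    exact h (by rw [tent, clamp_of_one_le (by linarith), clamp_of_one_le (by push_cast; linarith),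
      sub_self])

/-- Each hat is a difference of consecutive clamps, so the sum telescopes. -/
theorem sum_tent (n : ℕ) (σ : ℝ) :
    ∑ i ∈ Finset.range n, tent i σ = clamp (σ + 1) - clamp (σ + 1 - n) := by
  have := Finset.sum_range_sub' (fun i : ℕ => clamp (σ + 1 - i)) n
  simpa [tent] using this

theorem sum_tent_le_one (n : ℕ) (σ : ℝ) : ∑ i ∈ Finset.range n, tent i σ ≤ 1 := by
  rw [sum_tent]
  have := clamp_nonneg (σ + 1 - n)
  have := clamp_le_one (σ + 1)
  linarith

theorem sum_tent_eq_one {n : ℕ} {σ : ℝ} (h0 : 0 ≤ σ) (h1 : σ + 1 ≤ n) :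
    ∑ i ∈ Finset.range n, tent i σ = 1 := by
  rw [sum_tent, clamp_of_one_le (by linarith), clamp_of_nonpos (by linarith), sub_zero]

theorem continuous_tent (i : ℕ) : Continuous (tent i) := by
  unfold tent
  exact (continuous_clamp.comp (by fun_prop)).sub (continuous_clamp.comp (by fun_prop))

end Tent

/-! ### The L₁ norm and the angular part -/

section Norm

variable {p : ℕ}

theorem norm₁_nonneg (v : Fin p → ℝ) : 0 ≤ norm₁ v := Finset.sum_nonneg fun _ _ => abs_nonneg _

theorem abs_sum_mul_le (z v : Fin p → ℝ) : |∑ j, z j * v j| ≤ (∑ j, |z j|) * norm₁ v := by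
  refine (Finset.abs_sum_le_sum_abs _ _).trans ?_
  rw [norm₁, Finset.mul_sum]
  refine Finset.sum_le_sum fun j _ => ?_
  rw [abs_mul]
  gcongr
  exact Finset.single_le_sum (f := fun j => |z j|) (fun _ _ => abs_nonneg _) (Finset.mem_univ j)

theorem norm₁_mul_sum_angular (z v : Fin p → ℝ) :
    norm₁ v * ∑ j, z j * angular v j = ∑ j, z j * v j := by
  rcases (norm₁_nonneg v).eq_or_lt with h | h
  · have := abs_sum_mul_le z v
    rw [← h, mul_zero] at this
    rw [← h, zero_mul, abs_nonpos_iff.1 this]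
  · rw [Finset.mul_sum]
    refine Finset.sum_congr rfl fun j _ => ?_
    simp only [angular, Pi.smul_apply, smul_eq_mul]
    field_simp

theorem norm₁_angular {v : Fin p → ℝ} (h : 0 < norm₁ v) : norm₁ (angular v) = 1 := by
  have h1 : norm₁ (angular v) = (norm₁ v)⁻¹ * norm₁ v := by
    simp only [norm₁, angular, Pi.smul_apply, smul_eq_mul, abs_mul, ← Finset.mul_sum]
    rw [abs_of_nonneg (inv_nonneg.2 (Finset.sum_nonneg fun _ _ => abs_nonneg _))]
  rw [h1, inv_mul_cancel₀ h.ne']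

theorem continuous_norm₁ : Continuous (norm₁ : (Fin p → ℝ) → ℝ) := by unfold norm₁; fun_prop

theorem measurable_angular : Measurable (angular : (Fin p → ℝ) → Fin p → ℝ) :=
  continuous_norm₁.measurable.inv.smul measurable_id

end Norm

/-! ### Linear forms of a multivariate regularly varying vector -/

section LinearForm

variable {F : Measure ℝ} {α : ℝ} {Ω : Type*} [MeasurableSpace Ω] {P : Measure Ω}
  [IsProbabilityMeasure P] {p : ℕ}

/-- The integral over the event is its probability times the conditional expectation. The
probability is that of ‖V‖ > x/t, which produces t^α. Allowing t = 0 is needed for the lowest cells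
of the partition used below. -/
theorem tendsto_setIntegral_angular [IsFiniteMeasure F] (hF : IsRegularlyVarying F α)
    {V : Ω → Fin p → ℝ} {b : ℝ}
    (hb : TailEquiv (fun x => P.real {ω | x < norm₁ (V ω)}) b (tail F)) {μ : Measure (Fin p → ℝ)}
    (f : BoundedContinuousFunction (Fin p → ℝ) ℝ)
    (hμ : Tendsto (fun x : ℝ => ∫ ω, f (angular (V ω)) ∂(P[|{ω | x < norm₁ (V ω)}])) atTop
      (𝓝 (∫ θ, f θ ∂μ))) {t : ℝ} (ht : 0 ≤ t) :
    Tendsto (fun x : ℝ => (∫ ω in {ω | x < t * norm₁ (V ω)}, f (angular (V ω)) ∂P) / tail F x)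
      atTop (𝓝 (b * (t ^ α * ∫ θ, f θ ∂μ))) := by
  rcases ht.eq_or_lt with rfl | ht
  · rw [Real.zero_rpow hF.1.ne', zero_mul, mul_zero]
    refine tendsto_const_nhds.congr' ?_
    filter_upwards [eventually_gt_atTop 0] with x hx
    simp [not_lt.2 hx.le]
  have h1 := (hb.comp_mul hF (inv_pos.2 ht)).mul
    (hμ.comp (tendsto_id.const_mul_atTop (inv_pos.2 ht)))
  have h2 : b * t⁻¹ ^ (-α) * ∫ θ, f θ ∂μ = b * (t ^ α * ∫ θ, f θ ∂μ) := by
    rw [Real.rpow_neg_eq_inv_rpow, inv_inv, mul_assoc]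
  rw [h2] at h1
  refine h1.congr fun x => ?_
  have hset : {ω | x < t * norm₁ (V ω)} = {ω | t⁻¹ * x < norm₁ (V ω)} := by
    ext ω
    exact (inv_mul_lt_iff₀ ht).symm
  simp only [Function.comp, id]
  rw [hset, ProbabilityTheory.cond, integral_smul_measure, ENNReal.toReal_inv, smul_eq_mul,
    div_mul_eq_mul_div]
  congr 1
  by_cases h : P {ω | t⁻¹ * x < norm₁ (V ω)} = 0
  · rw [Measure.restrict_eq_zero.2 h]
    simp
  · rw [Measure.real, mul_inv_cancel_left₀]
    exact ENNReal.toReal_ne_zero.2 ⟨h, measure_ne_top _ _⟩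

/-- Under multivariate regular variation, the tail of a linear form of the vector is a multiple of
the reference tail, up to a negligible error. -/
theorem MRV.exists_tailEquiv_linear [IsFiniteMeasure F] (hF : IsRegularlyVarying F α)
    {V : Ω → Fin p → ℝ} (hV : Measurable V) {b : ℝ} (hMRV : MRV P F V b) (z : Fin p → ℝ) :
    ∃ d, 0 ≤ d ∧ TailEquiv (fun x => P.real {ω | x < ∑ j, z j * V ω j}) d (tail F) := by
  obtain ⟨hb, h0 | ⟨hbpos, μ, hμ, hμ1, hlim⟩⟩ := hMRV
  · refine ⟨0, le_rfl, ?_⟩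
    set M := ∑ j, |z j| + 1 with hM
    have hM0 : 0 < M := by
      have := Finset.sum_nonneg fun j (_ : j ∈ Finset.univ) => abs_nonneg (z j)
      linarith
    have h1 := hb.comp_mul hF (inv_pos.2 hM0)
    rw [h0, zero_mul] at h1
    refine squeeze_zero (fun x => div_nonneg measureReal_nonneg (tail_nonneg _ _)) (fun x => ?_) h1
    refine div_le_div_of_nonneg_right (measureReal_mono fun ω hω => ?_) (tail_nonneg _ _)
    have h2 := (le_abs_self _).trans (abs_sum_mul_le z (V ω))
    have h3 := norm₁_nonneg (V ω)
    simp only [Set.mem_ofPred_eq] at hω ⊢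
    rw [inv_mul_lt_iff₀ hM0]
    nlinarith
  set M := ∑ j, |z j| with hM
  have hM0 : 0 ≤ M := Finset.sum_nonneg fun j _ => abs_nonneg _
  set g : (Fin p → ℝ) → ℝ := fun θ => ∑ j, z j * θ j with hg
  have hgc : Continuous g := by fun_prop
  have hgM : ∀ θ, norm₁ θ = 1 → g θ ≤ M := fun θ h => by
    have := (le_abs_self _).trans (abs_sum_mul_le z θ)
    rwa [h, mul_one] at this
  -- For V = ‖V‖θ the form exceeds x > 0 exactly when ‖V‖ > x / g(θ) with g(θ) > 0. Averaging the
  -- factor g(θ)^α over directions gives the limit constant b ∫ ψ dμ.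
  set ψ : (Fin p → ℝ) → ℝ := fun θ => max 0 (g θ) ^ α with hψ
  have hψc : Continuous ψ := (continuous_const.max hgc).rpow_const fun _ => Or.inr hF.1.le
  have hψ0 : ∀ θ, 0 ≤ ψ θ := fun θ => Real.rpow_nonneg (le_max_left _ _) _
  have hψi : Integrable ψ μ := by
    refine .of_bound hψc.aestronglyMeasurable (M ^ α) (hμ1.mono fun θ hθ => ?_)
    rw [Real.norm_of_nonneg (hψ0 θ)]
    exact Real.rpow_le_rpow (le_max_left _ _) (max_le hM0 (hgM θ hθ)) hF.1.le
  -- upper and lower bounds, up to an arbitrary error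
  have key : ∀ η > 0, ∃ l u : ℝ, b * ∫ θ, ψ θ ∂μ - b * η ≤ l ∧ u ≤ b * ∫ θ, ψ θ ∂μ + b * η ∧
      ∃ L U : ℝ → ℝ, Tendsto L atTop (𝓝 l) ∧ Tendsto U atTop (𝓝 u) ∧
        ∀ x > 0, L x ≤ P.real {ω | x < ∑ j, z j * V ω j} / tail F x ∧
          P.real {ω | x < ∑ j, z j * V ω j} / tail F x ≤ U x := by
    intro η hη
    have huc : UniformContinuousOn (fun s : ℝ => s ^ α) (Set.Icc 0 (M + 3)) :=
      isCompact_Icc.uniformContinuousOn_of_continuous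
        (Real.continuous_rpow_const hF.1.le).continuousOn
    obtain ⟨δ, hδ, hδη⟩ := Metric.uniformContinuousOn_iff.1 huc η hη
    -- The grid has mesh 1/k, and a hat is supported on two cells; 2/k < δ keeps the oscillation of
    -- s ↦ s^α on each support below η.
    obtain ⟨k, hk⟩ := exists_nat_gt (max 1 (2 / δ))
    have hk1 : (1 : ℝ) < k := (le_max_left _ _).trans_lt hk
    have hk0 : (0 : ℝ) < k := by linarith
    have hkδ : 2 / (k : ℝ) < δ := (div_lt_comm₀ hδ hk0).1 ((le_max_right _ _).trans_lt hk)
    set n := ⌈(k : ℝ) * M⌉₊ + 1 with hn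
    have hn1 : (k : ℝ) * M + 1 ≤ n := by
      have := Nat.le_ceil ((k : ℝ) * M)
      rw [hn]; push_cast; linarith
    have hn2 : (n : ℝ) ≤ k * M + 2 := by
      have := (Nat.ceil_lt_add_one (mul_nonneg hk0.le hM0)).le
      rw [hn]; push_cast; linarith
    -- On the support of the i-th hat, the positive part of g lies between these two values. The
    -- truncated subtraction makes `lo 0 = 0`, as suits directions where g is negative.
    set up : ℕ → ℝ := fun i => ((i + 1 : ℕ) : ℝ) / k with hup
    set lo : ℕ → ℝ := fun i => ((i - 1 : ℕ) : ℝ) / k with hlo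
    have hup0 : ∀ i, 0 ≤ up i := fun i => by positivity
    have hlo0 : ∀ i, 0 ≤ lo i := fun i => by positivity
    have hloup : ∀ i, lo i ≤ up i := fun i => by
      simp only [hup, hlo]
      gcongr
      omega
    have hω : ∀ i ∈ Finset.range n, up i ^ α ≤ lo i ^ α + η := fun i hi => by
      have h1 : up i ≤ M + 3 := by
        simp only [hup]
        rw [div_le_iff₀ hk0]
        have : ((i + 1 : ℕ) : ℝ) ≤ n := by exact_mod_cast Finset.mem_range.1 hi
        nlinarith
      have h2 : up i - lo i ≤ 2 / k := by
        simp only [hup, hlo]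
        rw [← sub_div]
        gcongr
        have : ((i + 1 : ℕ) : ℝ) ≤ ((i - 1 : ℕ) : ℝ) + 2 := by
          exact_mod_cast (by omega : i + 1 ≤ i - 1 + 2)
        linarith
      have h3 := hδη (up i) ⟨hup0 i, h1⟩ (lo i) ⟨hlo0 i, (hloup i).trans h1⟩ (by
        rw [Real.dist_eq, abs_of_nonneg (sub_nonneg.2 (hloup i))]
        linarith)
      rw [Real.dist_eq] at h3
      linarith [(le_abs_self _).trans_lt h3]
    set f : ℕ → BoundedContinuousFunction (Fin p → ℝ) ℝ := fun i =>
      BoundedContinuousFunction.ofNormedAddCommGroup (fun θ => tent i (k * g θ))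
        ((continuous_tent i).comp (continuous_const.mul hgc)) 1 fun θ => by
          rw [Real.norm_of_nonneg (tent_nonneg _ _)]; exact tent_le_one _ _ with hf
    have hf_apply : ∀ i θ, f i θ = tent i (k * g θ) := fun i θ => rfl
    have hf0 : ∀ i θ, 0 ≤ f i θ := fun i θ => tent_nonneg _ _
    have hfsum : ∀ θ, ∑ i ∈ Finset.range n, f i θ ≤ 1 := fun θ => sum_tent_le_one _ _
    have hfsum1 : ∀ θ, 0 ≤ g θ → g θ ≤ M → ∑ i ∈ Finset.range n, f i θ = 1 := fun θ h1 h2 =>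
      sum_tent_eq_one (mul_nonneg hk0.le h1)
        ((add_le_add_left (mul_le_mul_of_nonneg_left h2 hk0.le) 1).trans hn1)
    have hflo : ∀ i θ, f i θ ≠ 0 → lo i ≤ max 0 (g θ) := fun i θ h => by
      have h1 := (lt_of_tent_ne_zero h).1
      simp only [hlo]
      rcases Nat.eq_zero_or_pos i with rfl | hi
      · simp
      · rw [Nat.cast_pred hi, div_le_iff₀ hk0]
        have := mul_le_mul_of_nonneg_right (le_max_right 0 (g θ)) hk0.le
        linarith
    have hfup : ∀ i θ, f i θ ≠ 0 → g θ ≤ up i := fun i θ h => by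
      have h1 := (lt_of_tent_ne_zero h).2
      simp only [hup]
      rw [le_div_iff₀ hk0]
      push_cast
      linarith
    have hfi : ∀ i, Integrable (f i) μ := fun i => (f i).integrable μ
    have hlou : ∑ i ∈ Finset.range n, lo i ^ α * ∫ θ, f i θ ∂μ =
        ∫ θ, ∑ i ∈ Finset.range n, lo i ^ α * f i θ ∂μ := by
      rw [integral_finsetSum _ fun i _ => (hfi i).const_mul _]
      simp only [integral_const_mul]
    have hupu : ∑ i ∈ Finset.range n, up i ^ α * ∫ θ, f i θ ∂μ =
        ∫ θ, ∑ i ∈ Finset.range n, up i ^ α * f i θ ∂μ := by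
      rw [integral_finsetSum _ fun i _ => (hfi i).const_mul _]
      simp only [integral_const_mul]
    have hdiff : ∀ θ, ∑ i ∈ Finset.range n, up i ^ α * f i θ ≤
        ∑ i ∈ Finset.range n, lo i ^ α * f i θ + η := fun θ => by
      calc ∑ i ∈ Finset.range n, up i ^ α * f i θ
          ≤ ∑ i ∈ Finset.range n, (lo i ^ α + η) * f i θ :=
            Finset.sum_le_sum fun i hi => mul_le_mul_of_nonneg_right (hω i hi) (hf0 i θ)
        _ = ∑ i ∈ Finset.range n, lo i ^ α * f i θ + η * ∑ i ∈ Finset.range n, f i θ := by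
            rw [Finset.mul_sum, ← Finset.sum_add_distrib]
            simp only [add_mul]
        _ ≤ _ := by
            have := mul_le_mul_of_nonneg_left (hfsum θ) hη.le
            linarith
    have hψlo : ∀ θ, ∑ i ∈ Finset.range n, lo i ^ α * f i θ ≤ ψ θ := fun θ => by
      calc ∑ i ∈ Finset.range n, lo i ^ α * f i θ ≤ ∑ i ∈ Finset.range n, ψ θ * f i θ := by
            refine Finset.sum_le_sum fun i _ => ?_
            by_cases h : f i θ = 0
            · simp [h]
            · exact mul_le_mul_of_nonneg_right
                (Real.rpow_le_rpow (hlo0 i) (hflo i θ h) hF.1.le) (hf0 i θ)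
        _ = ψ θ * ∑ i ∈ Finset.range n, f i θ := by rw [Finset.mul_sum]
        _ ≤ ψ θ := mul_le_of_le_one_right (hψ0 θ) (hfsum θ)
    have hψup : ∀ θ, norm₁ θ = 1 → ψ θ ≤ ∑ i ∈ Finset.range n, up i ^ α * f i θ := fun θ hθ => by
      rcases le_total (g θ) 0 with h | h
      · have : ψ θ = 0 := by simp only [hψ]; rw [max_eq_left h, Real.zero_rpow hF.1.ne']
        rw [this]
        exact Finset.sum_nonneg fun i _ => mul_nonneg (Real.rpow_nonneg (hup0 i) _) (hf0 i θ)
      · calc ψ θ = ψ θ * ∑ i ∈ Finset.range n, f i θ := by rw [hfsum1 θ h (hgM θ hθ), mul_one]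
          _ = ∑ i ∈ Finset.range n, ψ θ * f i θ := by rw [Finset.mul_sum]
          _ ≤ _ := by
            refine Finset.sum_le_sum fun i _ => ?_
            by_cases h' : f i θ = 0
            · simp [h']
            · exact mul_le_mul_of_nonneg_right (Real.rpow_le_rpow (le_max_left _ _)
                (max_le (hup0 i) (hfup i θ h')) hF.1.le) (hf0 i θ)
    have iup : Integrable (fun θ => ∑ i ∈ Finset.range n, up i ^ α * f i θ) μ :=
      integrable_finsetSum _ fun i _ => (hfi i).const_mul _
    have ilo : Integrable (fun θ => ∑ i ∈ Finset.range n, lo i ^ α * f i θ) μ :=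
      integrable_finsetSum _ fun i _ => (hfi i).const_mul _
    have h1 : ∫ θ, ∑ i ∈ Finset.range n, up i ^ α * f i θ ∂μ ≤ ∫ θ, ψ θ ∂μ + η := by
      have : ∫ θ, (ψ θ + η) ∂μ = ∫ θ, ψ θ ∂μ + η := by
        rw [integral_add hψi (integrable_const η)]; simp
      rw [← this]
      exact integral_mono iup (hψi.add (integrable_const η)) fun θ =>
        (hdiff θ).trans (add_le_add_left (hψlo θ) η)
    have h2 : ∫ θ, ψ θ ∂μ ≤ ∫ θ, ∑ i ∈ Finset.range n, lo i ^ α * f i θ ∂μ + η := by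
      have : ∫ θ, (∑ i ∈ Finset.range n, lo i ^ α * f i θ + η) ∂μ =
          ∫ θ, ∑ i ∈ Finset.range n, lo i ^ α * f i θ ∂μ + η := by
        rw [integral_add ilo (integrable_const η)]; simp
      rw [← this]
      exact integral_mono_ae hψi (ilo.add (integrable_const η))
        (hμ1.mono fun θ hθ => (hψup θ hθ).trans (hdiff θ))
    have hT : Measurable fun ω => norm₁ (V ω) := continuous_norm₁.measurable.comp hV
    have hlin : Measurable fun ω => ∑ j, z j * V ω j := hgc.measurable.comp hV
    have hms : ∀ x : ℝ, MeasurableSet {ω | x < ∑ j, z j * V ω j} := fun x =>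
      measurableSet_lt measurable_const hlin
    have hmt : ∀ x t : ℝ, MeasurableSet {ω | x < t * norm₁ (V ω)} := fun x t =>
      measurableSet_lt measurable_const (hT.const_mul t)
    have hfP : ∀ i, Integrable (fun ω => f i (angular (V ω))) P := fun i =>
      .of_bound ((f i).continuous.measurable.comp
        (measurable_angular.comp hV)).aestronglyMeasurable 1 (.of_forall fun ω => by
          rw [Real.norm_of_nonneg (hf0 _ _)]; exact tent_le_one _ _)
    -- Each hat isolates directions where g is almost constant, so the limit is a Riemann sum for b
    -- ∫ ψ dμ, from below with `lo` and from above with `up`.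
    have hlims : ∀ t : ℕ → ℝ, (∀ i, 0 ≤ t i) → Tendsto (fun x => ∑ i ∈ Finset.range n,
        (∫ ω in {ω | x < t i * norm₁ (V ω)}, f i (angular (V ω)) ∂P) / tail F x) atTop
          (𝓝 (b * ∑ i ∈ Finset.range n, t i ^ α * ∫ θ, f i θ ∂μ)) := fun t ht => by
      rw [Finset.mul_sum]
      exact tendsto_finsetSum _ fun i _ => tendsto_setIntegral_angular hF hb (f i)
        (hlim (f i)) (ht i)
    have hsumint : ∀ (t : ℕ → ℝ) (x : ℝ), ∑ i ∈ Finset.range n,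
        (∫ ω in {ω | x < t i * norm₁ (V ω)}, f i (angular (V ω)) ∂P) / tail F x =
        (∫ ω, ∑ i ∈ Finset.range n, {ω | x < t i * norm₁ (V ω)}.indicator
          (fun ω => f i (angular (V ω))) ω ∂P) / tail F x := fun t x => by
      rw [integral_finsetSum _ fun i _ => (hfP i).indicator (hmt x _), Finset.sum_div]
      simp only [integral_indicator (hmt x _)]
    have hsumi : ∀ (t : ℕ → ℝ) (x : ℝ), Integrable (fun ω => ∑ i ∈ Finset.range n,
        {ω | x < t i * norm₁ (V ω)}.indicator (fun ω => f i (angular (V ω))) ω) P := fun t x =>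
      integrable_finsetSum _ fun i _ => (hfP i).indicator (hmt x _)
    refine ⟨_, _, ?_, ?_, _, _, hlims lo hlo0, hlims up hup0, fun x hx => ?_⟩
    · rw [hlou, ← mul_sub]
      exact mul_le_mul_of_nonneg_left (by linarith) hbpos.le
    · rw [hupu, ← mul_add]
      exact mul_le_mul_of_nonneg_left h1 hbpos.le
    · have hi : Integrable ({ω | x < ∑ j, z j * V ω j}.indicator fun _ => (1 : ℝ)) P :=
        (integrable_const 1).indicator (hms x)
      rw [hsumint, hsumint, ← integral_indicator_one (hms x)]
      constructor
      · refine div_le_div_of_nonneg_right (integral_mono (hsumi lo x) hi fun ω => ?_)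
          (tail_nonneg _ _)
        have h3 : ∀ i, {ω | x < lo i * norm₁ (V ω)}.indicator
            (fun ω => f i (angular (V ω))) ω ≤
            {ω | x < ∑ j, z j * V ω j}.indicator (fun _ => (1 : ℝ)) ω * f i (angular (V ω)) := by
          intro i
          have h4 : 0 ≤ {ω | x < ∑ j, z j * V ω j}.indicator (fun _ => (1 : ℝ)) ω :=
            Set.indicator_nonneg (fun _ _ => zero_le_one) _
          by_cases h : f i (angular (V ω)) = 0
          · rw [h, mul_zero]
            exact Set.indicator_apply_le' (fun _ => h.le) fun _ => le_rfl
          · refine Set.indicator_apply_le' (fun hω => ?_) fun _ => mul_nonneg h4 (hf0 _ _)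
            rw [Set.indicator_of_mem, one_mul]
            rw [Set.mem_ofPred_eq] at hω ⊢
            have h5 := hω.trans_le
              (mul_le_mul_of_nonneg_right (hflo i _ h) (norm₁_nonneg (V ω)))
            rw [← norm₁_mul_sum_angular z (V ω)]
            rcases le_total (g (angular (V ω))) 0 with h6 | h6
            · rw [max_eq_left h6, zero_mul] at h5
              linarith
            · rwa [max_eq_right h6, mul_comm] at h5
        refine (Finset.sum_le_sum fun i _ => h3 i).trans ?_
        rw [← Finset.mul_sum]
        exact mul_le_of_le_one_right (Set.indicator_nonneg (fun _ _ => zero_le_one) _) (hfsum _)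
      · refine div_le_div_of_nonneg_right (integral_mono hi (hsumi up x) fun ω => ?_)
          (tail_nonneg _ _)
        refine Set.indicator_apply_le' (fun hω => ?_) fun _ => Finset.sum_nonneg fun i _ =>
          Set.indicator_nonneg (fun _ _ => hf0 _ _) _
        rw [Set.mem_ofPred_eq, ← norm₁_mul_sum_angular z (V ω)] at hω
        have h3 : 0 < norm₁ (V ω) := by
          refine (norm₁_nonneg _).lt_of_ne fun h => ?_
          rw [← h, zero_mul] at hω
          linarith
        have h4 : 0 < g (angular (V ω)) := (pos_iff_pos_of_mul_pos (hx.trans hω)).1 h3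
        rw [Pi.one_apply, ← hfsum1 _ h4.le (hgM _ (norm₁_angular h3))]
        refine Finset.sum_le_sum fun i _ => ?_
        by_cases h : f i (angular (V ω)) = 0
        · rw [h]
          exact Set.indicator_nonneg (fun _ _ => hf0 _ _) _
        · rw [Set.indicator_of_mem]
          rw [Set.mem_ofPred_eq]
          refine hω.trans_le ?_
          rw [mul_comm]
          exact mul_le_mul_of_nonneg_right (hfup i _ h) h3.le
  refine ⟨b * ∫ θ, ψ θ ∂μ, mul_nonneg hbpos.le (integral_nonneg hψ0),
    tendsto_order.2 ⟨fun a ha => ?_, fun a ha => ?_⟩⟩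
  -- The η supplied here makes the error bη half of the gap to a.
  · obtain ⟨l, u, hl, _, L, U, hL, _, h⟩ :=
      key ((b * ∫ θ, ψ θ ∂μ - a) / (2 * b)) (div_pos (sub_pos.2 ha) (by positivity))
    have h1 : b * ((b * ∫ θ, ψ θ ∂μ - a) / (2 * b)) = (b * ∫ θ, ψ θ ∂μ - a) / 2 := by
      field_simp
    filter_upwards [hL.eventually_const_lt (show a < l by linarith), eventually_gt_atTop 0]
      with x h2 h3
    exact h2.trans_le (h x h3).1
  · obtain ⟨l, u, _, hu, L, U, _, hU, h⟩ :=
      key ((a - b * ∫ θ, ψ θ ∂μ) / (2 * b)) (div_pos (sub_pos.2 ha) (by positivity))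
    have h1 : b * ((a - b * ∫ θ, ψ θ ∂μ) / (2 * b)) = (a - b * ∫ θ, ψ θ ∂μ) / 2 := by
      field_simp
    filter_upwards [hU.eventually_lt_const (show u < a by linarith), eventually_gt_atTop 0]
      with x h2 h3
    exact (h x h3).2.trans_lt h2

end LinearForm

/-! ### Conditioning on a countably valued variable -/

section Conditioning

variable {Ω β γ : Type*} [MeasurableSpace Ω] {P : Measure Ω} [IsProbabilityMeasure P]
  [MeasurableSpace β] [Countable β] [MeasurableSingletonClass β] [MeasurableSpace γ]

/-- Fubini for the joint law, a product by independence. Countability of the values of N settles all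
measurability in n. -/
theorem measureReal_eq_integral_of_indepFun {N : Ω → β} {Y : Ω → γ} (hN : Measurable N)
    (hY : Measurable Y) (hNY : IndepFun N Y P) {E : β → Set γ} (hE : ∀ n, MeasurableSet (E n)) :
    P.real {ω | Y ω ∈ E (N ω)} = ∫ ω, P.real {ω' | Y ω' ∈ E (N ω)} ∂P := by
  have hEm : MeasurableSet {q : β × γ | q.2 ∈ E q.1} := by
    have : {q : β × γ | q.2 ∈ E q.1} = ⋃ n, {n} ×ˢ E n := by
      ext ⟨n, y⟩
      simp [Set.mem_iUnion, Set.mem_prod]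
    rw [this]
    exact .iUnion fun n => (measurableSet_singleton n).prod (hE n)
  have hm := (indepFun_iff_map_prod_eq_prod_map_map hN.aemeasurable hY.aemeasurable).1 hNY
  have h1 : P {ω | Y ω ∈ E (N ω)} = ∫⁻ ω, P {ω' | Y ω' ∈ E (N ω)} ∂P := by
    calc P {ω | Y ω ∈ E (N ω)}
        = P.map (fun ω => (N ω, Y ω)) {q : β × γ | q.2 ∈ E q.1} :=
          (Measure.map_apply (hN.prodMk hY) hEm).symm
      _ = ∫⁻ n, P.map Y (E n) ∂(P.map N) := by
          rw [hm, Measure.prod_apply hEm]; rfl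
      _ = ∫⁻ ω, P.map Y (E (N ω)) ∂P := lintegral_map (measurable_of_countable _) hN
      _ = _ := by
          refine lintegral_congr fun ω => ?_
          rw [Measure.map_apply hY (hE _)]
          rfl
  rw [Measure.real, h1, ← integral_toReal]
  · rfl
  · exact ((measurable_of_countable (fun n => P {ω' | Y ω' ∈ E n})).comp hN).aemeasurable
  · exact .of_forall fun ω => measure_lt_top _ _

end Conditioning

/-! ### Integrability and the mean law of large numbers -/

section Moments

variable {F : Measure ℝ} {Ω : Type*} [MeasurableSpace Ω] {P : Measure Ω}

/-- Layer-cake formula: levels below a contribute at most a bounded interval, the others at most a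
multiple of the integrated tail of F, finite because F has finite mean. -/
theorem integrable_of_eventually_le_tail [IsProbabilityMeasure P] [IsFiniteMeasure F]
    (hF : Integrable (fun z : ℝ => z) F)
    {f : Ω → ℝ} (hf : Measurable f) (hf0 : ∀ ω, 0 ≤ f ω) {C : ℝ}
    (hC : ∀ᶠ x in atTop, P.real {ω | x < f ω} ≤ C * tail F x) : Integrable f P := by
  obtain ⟨a, ha⟩ := eventually_atTop.1 hC
  have h1 : ∫⁻ t in Set.Ioi (0 : ℝ), F (Set.Ioi t) < ⊤ := by
    have h2 := lintegral_eq_lintegral_meas_lt F (f := fun z => max z 0)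
      (.of_forall fun z => le_max_right _ _) (measurable_id.max measurable_const).aemeasurable
    have h3 : ∫⁻ t in Set.Ioi (0 : ℝ), F {z | t < max z 0} =
        ∫⁻ t in Set.Ioi (0 : ℝ), F (Set.Ioi t) := by
      refine setLIntegral_congr_fun measurableSet_Ioi fun t ht => ?_
      congr 1
      ext z
      simp only [Set.mem_ofPred_eq, lt_max_iff, Set.mem_Ioi]
      exact ⟨fun h => h.resolve_right (not_lt.2 (le_of_lt ht)), Or.inl⟩
    rw [← h3, ← h2]
    exact hF.pos_part.lintegral_lt_top
  refine ⟨hf.aestronglyMeasurable, ?_⟩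
  rw [hasFiniteIntegral_iff_ofReal (.of_forall hf0),
    lintegral_eq_lintegral_meas_lt P (.of_forall hf0) hf.aemeasurable]
  calc ∫⁻ t in Set.Ioi (0 : ℝ), P {ω | t < f ω}
      ≤ ∫⁻ t in Set.Ioi (0 : ℝ),
          ((Set.Iio a).indicator 1 t + ENNReal.ofReal C * F (Set.Ioi t)) := by
        refine lintegral_mono fun t => ?_
        by_cases ht : t < a
        · rw [Set.indicator_of_mem (show t ∈ Set.Iio a from ht)]
          exact prob_le_one.trans le_self_add
        · refine le_trans ?_ le_add_self
          have h2 := ha t (not_lt.1 ht)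
          have h3 := ENNReal.ofReal_le_ofReal h2
          rw [tail, ENNReal.ofReal_mul' measureReal_nonneg, ofReal_measureReal,
            ofReal_measureReal] at h3
          exact h3
    _ = (∫⁻ t in Set.Ioi (0 : ℝ), (Set.Iio a).indicator 1 t) +
          ENNReal.ofReal C * ∫⁻ t in Set.Ioi (0 : ℝ), F (Set.Ioi t) := by
        rw [lintegral_add_left (measurable_one.indicator measurableSet_Iio),
          lintegral_const_mul' _ _ ENNReal.ofReal_ne_top]
    _ < ⊤ := by
        refine ENNReal.add_lt_top.2 ⟨?_, ENNReal.mul_lt_top ENNReal.ofReal_lt_top h1⟩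
        rw [lintegral_indicator_one measurableSet_Iio, Measure.restrict_apply measurableSet_Iio]
        exact (measure_mono (fun t ht => (⟨ht.2.le, ht.1.le⟩ : t ∈ Set.Icc 0 a))).trans_lt
          measure_Icc_lt_top

/-- The law of large numbers in mean, as a bound which holds for all numbers of summands. -/
theorem exists_integral_abs_sum_sub_le {Z : ℕ → Ω → ℝ} (hZ : ∀ m, Measurable (Z m))
    (hind : Pairwise fun i j => IndepFun (Z i) (Z j) P) {H : Measure ℝ}
    (hlaw : ∀ m, P.map (Z m) = H) (hH : Integrable (fun z : ℝ => z) H) {η : ℝ} (hη : 0 < η) :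
    ∃ C, 0 ≤ C ∧ ∀ n : ℕ,
      ∫ ω, |∑ m ∈ Finset.range n, Z m ω - n * ∫ z, z ∂H| ∂P ≤ η * n + C := by
  have hmean : ∫ ω, Z 0 ω ∂P = ∫ z, z ∂H := by
    rw [← hlaw 0]
    exact (integral_map (f := fun z => z) (hZ 0).aemeasurable
      measurable_id.aestronglyMeasurable).symm
  have hint : Integrable (Z 0) P := by
    rw [← hlaw 0] at hH
    exact hH.comp_measurable (hZ 0)
  have hlln := strong_law_Lp (p := 1) le_rfl ENNReal.one_ne_top Z (memLp_one_iff_integrable.2 hint)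
    hind fun m => ⟨(hZ m).aemeasurable, (hZ 0).aemeasurable, by rw [hlaw, hlaw]⟩
  obtain ⟨n₀, hn₀⟩ := eventually_atTop.1
    (hlln.eventually_lt_const (ENNReal.ofReal_pos.2 hη))
  set A : ℕ → ℝ := fun n => ∫ ω, |∑ m ∈ Finset.range n, Z m ω - n * ∫ z, z ∂H| ∂P with hA
  have hA0 : ∀ n, 0 ≤ A n := fun n => integral_nonneg fun ω => abs_nonneg _
  -- The additive constant pays for the finitely many n ≤ n₀; beyond them the L¹ law of large
  -- numbers gives ηn.
  refine ⟨∑ n ∈ Finset.range (n₀ + 1), A n, Finset.sum_nonneg fun n _ => hA0 n, fun n => ?_⟩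
  by_cases hn : n < n₀ + 1
  · have := Finset.single_le_sum (fun n _ => hA0 n) (Finset.mem_range.2 hn)
    have h2 : 0 ≤ η * n := by positivity
    linarith
  have hn0 : (0 : ℝ) < n := by exact_mod_cast (by omega : 0 < n)
  have h1 := (hn₀ n (by omega)).le
  have hmeas : Measurable fun ω => (n : ℝ)⁻¹ • ∑ i ∈ Finset.range n, Z i ω - ∫ ω, Z 0 ω ∂P := by
    fun_prop
  rw [eLpNorm_one_eq_lintegral_enorm] at h1
  have h2 := ENNReal.toReal_mono ENNReal.ofReal_ne_top h1
  rw [← integral_norm_eq_lintegral_enorm hmeas.aestronglyMeasurable,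
    ENNReal.toReal_ofReal hη.le, hmean] at h2
  have h3 : A n = n * ∫ ω, ‖(n : ℝ)⁻¹ • ∑ i ∈ Finset.range n, Z i ω - ∫ z, z ∂H‖ ∂P := by
    rw [← integral_const_mul]
    refine integral_congr_ae (.of_forall fun ω => ?_)
    simp only
    rw [Real.norm_eq_abs, smul_eq_mul, ← abs_of_pos hn0, ← abs_mul, abs_of_pos hn0, mul_sub,
      mul_inv_cancel_left₀ hn0.ne']
  have h4 := mul_le_mul_of_nonneg_left h2 hn0.le
  have h5 := Finset.sum_nonneg fun n (_ : n ∈ Finset.range (n₀ + 1)) => hA0 n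
  change A n ≤ _
  linarith

end Moments

/-! ### Sums indexed by deterministic counts -/

section PartialSum

variable {p : ℕ}

/-- The sum of the first `n j` entries of the `j`-th sequence, over all `j`. -/
def partialSum (n : Fin p → ℕ) (ζ : Fin p × ℕ → ℝ) : ℝ :=
  ∑ j, ∑ m ∈ Finset.range (n j), ζ (j, m)

/-- The indices of the entries which are summed in `partialSum`. -/
def indexSet (n : Fin p → ℕ) : Finset (Fin p × ℕ) :=
  (Finset.univ.sigma fun j => Finset.range (n j)).map (Equiv.sigmaEquivProd _ _).toEmbedding

theorem sum_indexSet {M : Type*} [AddCommMonoid M] (n : Fin p → ℕ) (f : Fin p × ℕ → M) :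
    ∑ q ∈ indexSet n, f q = ∑ j, ∑ m ∈ Finset.range (n j), f (j, m) := by
  rw [indexSet, Finset.sum_map, Finset.sum_sigma]
  rfl

theorem card_indexSet (n : Fin p → ℕ) : (indexSet n).card = ∑ j, n j := by
  simp [indexSet]

theorem measurable_partialSum (n : Fin p → ℕ) : Measurable (partialSum n) := by
  unfold partialSum
  fun_prop

theorem norm₁_natCast (n : Fin p → ℕ) : norm₁ (fun j => (n j : ℝ)) = ∑ j, (n j : ℝ) := by
  simp [norm₁]

end PartialSum

/-! ### Uniform concentration around the mean -/

section Concentration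

variable {Ω : Type*} [MeasurableSpace Ω] {P : Measure Ω} [IsProbabilityMeasure P] {p : ℕ}

/-- The weak law of large numbers, uniformly in the numbers of summands. -/
theorem eventually_measure_partialSum_sub_ge_le {Z : Fin p → ℕ → Ω → ℝ}
    (hZ : ∀ j m, Measurable (Z j m))
    (hind : iIndepFun (fun q : Fin p × ℕ => Z q.1 q.2) P) {H : Fin p → Measure ℝ}
    (hlaw : ∀ j m, P.map (Z j m) = H j) (hH : ∀ j, Integrable (fun z : ℝ => z) (H j))
    {δ B η : ℝ} (hδ : 0 < δ) (hB : 0 < B) (hη : 0 < η) :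
    ∀ᶠ x in atTop, ∀ n : Fin p → ℕ, ∑ j, (n j : ℝ) ≤ B * x →
      P.real {ω | δ * x ≤ |partialSum n (fun q => Z q.1 q.2 ω) -
        ∑ j, (∫ z, z ∂(H j)) * n j|} ≤ η := by
  -- In Markov's inequality at level δx the linear part κBx uses half of the allowance ηδx; the
  -- constants C fit in the other half once x is large.
  set κ := η * δ / (2 * B) with hκ
  have hκ0 : 0 < κ := by positivity
  have h1 : ∀ j, ∃ C, 0 ≤ C ∧ ∀ n : ℕ,
      ∫ ω, |∑ m ∈ Finset.range n, Z j m ω - n * ∫ z, z ∂(H j)| ∂P ≤ κ * n + C := fun j =>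
    exists_integral_abs_sum_sub_le (hZ j) (fun a b hab => hind.indepFun (i := (j, a)) (j := (j, b))
      fun h => hab (congrArg Prod.snd h)) (hlaw j) (hH j) hκ0
  choose C hC0 hC using h1
  filter_upwards [eventually_gt_atTop 0, eventually_ge_atTop (2 * (∑ j, C j) / (η * δ))]
    with x hx hxC n hn
  have hint : ∀ j m, Integrable (Z j m) P := fun j m => by
    have := hH j
    rw [← hlaw j m] at this
    exact this.comp_measurable (hZ j m)
  have hi : ∀ j, Integrable
      (fun ω => |∑ m ∈ Finset.range (n j), Z j m ω - n j * ∫ z, z ∂(H j)|) P := fun j =>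
    ((integrable_finsetSum _ fun m _ => hint j m).sub (integrable_const _)).abs
  have hle : ∀ ω, |partialSum n (fun q => Z q.1 q.2 ω) - ∑ j, (∫ z, z ∂(H j)) * n j| ≤
      ∑ j, |∑ m ∈ Finset.range (n j), Z j m ω - n j * ∫ z, z ∂(H j)| := fun ω => by
    rw [partialSum, ← Finset.sum_sub_distrib]
    refine (Finset.abs_sum_le_sum_abs _ _).trans (le_of_eq ?_)
    simp only [mul_comm]
  have h2 := mul_meas_ge_le_integral_of_nonneg (μ := P)
    (.of_forall fun ω => Finset.sum_nonneg fun j _ => abs_nonneg _)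
    (integrable_finsetSum Finset.univ fun j _ => hi j) (δ * x)
  rw [integral_finsetSum _ fun j _ => hi j] at h2
  have h3 : ∑ j, ∫ ω, |∑ m ∈ Finset.range (n j), Z j m ω - n j * ∫ z, z ∂(H j)| ∂P ≤
      η * (δ * x) := by
    refine (Finset.sum_le_sum fun j _ => hC j (n j)).trans ?_
    rw [Finset.sum_add_distrib, ← Finset.mul_sum]
    rw [div_le_iff₀ (by positivity)] at hxC
    have h4 := mul_le_mul_of_nonneg_left hn hκ0.le
    have h5 : κ * (B * x) = η * δ * x / 2 := by rw [hκ]; field_simp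
    linarith
  have h6 : P.real {ω | δ * x ≤ |partialSum n (fun q => Z q.1 q.2 ω) -
      ∑ j, (∫ z, z ∂(H j)) * n j|} ≤ P.real {ω | δ * x ≤
        ∑ j, |∑ m ∈ Finset.range (n j), Z j m ω - n j * ∫ z, z ∂(H j)|} :=
    measureReal_mono fun ω hω => le_trans hω (hle ω)
  refine h6.trans ?_
  have h7 := h2.trans h3
  rw [mul_comm η] at h7
  exact le_of_mul_le_mul_left h7 (by positivity)

end Concentration

/-! ### Few summands against many summands -/

section Main

variable {F : Measure ℝ} [IsProbabilityMeasure F] {α : ℝ}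
  {Ω : Type*} [MeasurableSpace Ω] {P : Measure Ω} [IsProbabilityMeasure P] {p : ℕ}
  {N : Fin p → Ω → ℕ} {Z : Fin p → ℕ → Ω → ℝ} {H : Fin p → Measure ℝ} {c : Fin p → ℝ}

/-- The contribution to the tail of a randomly stopped sum of the event that the number of
summands is small compared with the threshold. -/
theorem exists_tailEquiv_randomSum_small (hF : IsRegularlyVarying F α)
    (hN : ∀ j, Measurable (N j)) (hNi : ∀ j, Integrable (fun ω => (N j ω : ℝ)) P)
    (hZ : ∀ j m, Measurable (Z j m)) (hind : iIndepFun (fun q : Fin p × ℕ => Z q.1 q.2) P)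
    (hNZ : IndepFun (fun ω (j : Fin p) => N j ω) (fun ω (q : Fin p × ℕ) => Z q.1 q.2 ω) P)
    (hlaw : ∀ j m, P.map (Z j m) = H j) (hH : ∀ j, Integrable (fun z : ℝ => z) (H j))
    (hc : ∀ j, TailEquiv (tail (H j)) (c j) (tail F)) :
    ∃ ε₀ > 0, ∀ ε, 0 < ε → ε ≤ ε₀ → TailEquiv
      (fun x => P.real {ω | x < ∑ j, randomSum (Z j) (N j) ω ∧ ∑ j, (N j ω : ℝ) ≤ ε * x})
      (∑ j, c j * ∫ ω, (N j ω : ℝ) ∂P) (tail F) := by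
  have hprob : ∀ j, IsProbabilityMeasure (H j) := fun j => by
    rw [← hlaw j 0]
    exact Measure.isProbabilityMeasure_map (hZ j 0).aemeasurable
  obtain ⟨C, hC, ε₀, hε₀, hunif⟩ := exists_measure_sum_gt_le (P := P) hF hH hc
    (Z := fun q : Fin p × ℕ => Z q.1 q.2) (fun q => hZ q.1 q.2) hind (g := Prod.fst)
    fun q => hlaw q.1 q.2
  refine ⟨ε₀, hε₀, fun ε hε hεε₀ => ?_⟩
  set φ : ℝ → (Fin p → ℕ) → ℝ := fun x n =>
    P.real {ω | x < partialSum n (fun q => Z q.1 q.2 ω) ∧ ∑ j, (n j : ℝ) ≤ ε * x} with hφ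
  have hNm : Measurable fun ω j => N j ω := measurable_pi_lambda _ hN
  have hYm : Measurable fun ω (q : Fin p × ℕ) => Z q.1 q.2 ω :=
    measurable_pi_lambda _ fun q => hZ q.1 q.2
  have hcond : ∀ x : ℝ, P.real {ω | x < ∑ j, randomSum (Z j) (N j) ω ∧
      ∑ j, (N j ω : ℝ) ≤ ε * x} = ∫ ω, φ x (fun j => N j ω) ∂P := fun x =>
    measureReal_eq_integral_of_indepFun hNm hYm hNZ
      (E := fun n => {ζ | x < partialSum n ζ ∧ ∑ j, (n j : ℝ) ≤ ε * x}) fun n =>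
        (measurableSet_lt measurable_const (measurable_partialSum n)).inter (.const _)
  have hpart : ∀ n (ω : Ω), partialSum n (fun q => Z q.1 q.2 ω) =
      ∑ q ∈ indexSet n, Z q.1 q.2 ω := fun n ω => (sum_indexSet n fun q => Z q.1 q.2 ω).symm
  have hlimit : ∑ j, c j * ∫ ω, (N j ω : ℝ) ∂P = ∫ ω, ∑ j, c j * (N j ω : ℝ) ∂P := by
    rw [integral_finsetSum _ fun j _ => (hNi j).const_mul _]
    simp only [integral_const_mul]
  rw [hlimit]
  unfold TailEquiv
  simp only [hcond, ← integral_div]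
  -- The uniform bound supplies the integrable majorant C · T; the fixed-number asymptotics supply
  -- the pointwise limit.
  refine tendsto_integral_filter_of_dominated_convergence
    (fun ω => C * ∑ j, (N j ω : ℝ)) (.of_forall fun x => ?_) ?_
    ((integrable_finsetSum _ fun j _ => hNi j).const_mul C) (.of_forall fun ω => ?_)
  · exact (((measurable_of_countable (φ x)).comp hNm).div_const _).aestronglyMeasurable
  · filter_upwards [hunif, eventually_gt_atTop 0] with x hx hx0
    refine .of_forall fun ω => ?_
    have hp := hF.tail_pos x
    rw [Real.norm_of_nonneg (div_nonneg measureReal_nonneg hp.le), div_le_iff₀ hp]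
    by_cases h : ∑ j, (N j ω : ℝ) ≤ ε * x
    · have hcard : ((indexSet fun j => N j ω).card : ℝ) = ∑ j, (N j ω : ℝ) := by
        rw [card_indexSet]; push_cast; rfl
      have h1 := hx (indexSet fun j => N j ω) (by
        rw [hcard]; exact h.trans (mul_le_mul_of_nonneg_right hεε₀ hx0.le))
      rw [hcard] at h1
      refine le_trans (measureReal_mono fun ω' hω' => ?_) h1
      rw [Set.mem_ofPred_eq, ← hpart]
      exact hω'.1
    · have h1 : φ x (fun j => N j ω) = 0 := by simp [hφ, h]
      refine h1.le.trans ?_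
      have := Finset.sum_nonneg fun j (_ : j ∈ Finset.univ) => (N j ω).cast_nonneg (α := ℝ)
      positivity
  · have h1 := TailEquiv.sum_of_iIndepFun (P := P) hF (Z := fun q : Fin p × ℕ => Z q.1 q.2)
      (fun q => hZ q.1 q.2) hind (c := fun q => c q.1) (fun q => by
        have := hc q.1
        rw [← hlaw q.1 q.2] at this
        refine this.congr fun x => ?_
        rw [tail, map_measureReal_apply (hZ q.1 q.2) measurableSet_Ioi]
        rfl) (indexSet fun j => N j ω)
    rw [sum_indexSet] at h1
    simp only [Finset.sum_const, Finset.card_range, nsmul_eq_mul] at h1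
    simp only [mul_comm (c _)]
    refine h1.congr' ?_
    -- For a fixed ω the constraint T ≤ εx holds for all large x, so it does not affect the limit.
    have h2 : Tendsto (fun x : ℝ => ε * x) atTop atTop := tendsto_id.const_mul_atTop hε
    filter_upwards [h2.eventually_ge_atTop (∑ j, (N j ω : ℝ))] with x hx
    simp only [hφ, hpart, hx, and_true]

/-- The contribution to the tail of a randomly stopped sum of the event that the number of
summands is not small compared with the threshold. -/
theorem tailEquiv_randomSum_large (hF : IsRegularlyVarying F α)
    (hN : ∀ j, Measurable (N j)) {b : ℝ}
    (hb : TailEquiv (fun x => P.real {ω | x < ∑ j, (N j ω : ℝ)}) b (tail F)) {d : ℝ}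
    (hd : TailEquiv (fun x => P.real {ω | x < ∑ j, (∫ z, z ∂(H j)) * (N j ω : ℝ)}) d (tail F))
    (hZ : ∀ j m, Measurable (Z j m)) (hind : iIndepFun (fun q : Fin p × ℕ => Z q.1 q.2) P)
    (hNZ : IndepFun (fun ω (j : Fin p) => N j ω) (fun ω (q : Fin p × ℕ) => Z q.1 q.2 ω) P)
    (hlaw : ∀ j m, P.map (Z j m) = H j) (hH : ∀ j, Integrable (fun z : ℝ => z) (H j))
    {ε : ℝ} (hε : 0 < ε) (hεH : (∑ j, |∫ z, z ∂(H j)|) * ε ≤ 1) :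
    TailEquiv (fun x =>
      P.real {ω | x < ∑ j, randomSum (Z j) (N j) ω ∧ ε * x < ∑ j, (N j ω : ℝ)} -
        P.real {ω | x < ∑ j, (∫ z, z ∂(H j)) * (N j ω : ℝ)}) 0 (tail F) := by
  set T : Ω → ℝ := fun ω => ∑ j, (N j ω : ℝ) with hT
  set U : Ω → ℝ := fun ω => ∑ j, (∫ z, z ∂(H j)) * (N j ω : ℝ) with hU
  set S : Ω → ℝ := fun ω => ∑ j, randomSum (Z j) (N j) ω with hS
  have hNR : ∀ j, Measurable fun ω => (N j ω : ℝ) := fun j => measurable_from_nat.comp (hN j)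
  have hTm : Measurable T := Finset.measurable_sum _ fun j _ => hNR j
  have hUm : Measurable U := Finset.measurable_sum _ fun j _ => (hNR j).const_mul _
  have hNm : Measurable fun ω j => N j ω := measurable_pi_lambda _ hN
  have hYm : Measurable fun ω (q : Fin p × ℕ) => Z q.1 q.2 ω :=
    measurable_pi_lambda _ fun q => hZ q.1 q.2
  have hb0 : 0 ≤ b := hb.nonneg (fun _ => measureReal_nonneg) (tail_nonneg F)
  have hd0 : 0 ≤ d := hd.nonneg (fun _ => measureReal_nonneg) (tail_nonneg F)
  have hUT : ∀ ω, U ω ≤ (∑ j, |∫ z, z ∂(H j)|) * T ω := fun ω => by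
    have := (le_abs_self _).trans
      (abs_sum_mul_le (fun j => ∫ z, z ∂(H j)) fun j => (N j ω : ℝ))
    rwa [norm₁_natCast] at this
  -- the exceptional event
  have hbound : ∀ B > 0, ∀ δ, 0 < δ → δ < 1 → ∀ η > 0, ∀ᶠ x in atTop,
      |P.real {ω | x < S ω ∧ ε * x < T ω} - P.real {ω | x < U ω}| ≤
        P.real {ω | B * x < T ω} + η * P.real {ω | ε * x < T ω} +
          (P.real {ω | (1 - δ) * x < U ω} - P.real {ω | (1 + δ) * x < U ω}) := by
    intro B hB δ hδ hδ1 η hη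
    filter_upwards [eventually_measure_partialSum_sub_ge_le hZ hind hlaw hH hδ hB hη,
      eventually_gt_atTop 0] with x hx hx0
    -- Three ways to fail: too many summands, a deviation of S from U by at least δx, or U within δx
    -- of x. Outside them S > x and U > x agree when T > εx.
    set R₁ : Set Ω := {ω | B * x < T ω} with hR₁
    set R₂ : Set Ω := {ω | δ * x ≤ |S ω - U ω| ∧ ε * x < T ω ∧ T ω ≤ B * x} with hR₂
    set R₃ : Set Ω := {ω | (1 - δ) * x < U ω} \ {ω | (1 + δ) * x < U ω} with hR₃
    -- Conditioning on N retains the factor P(T > εx), itself of the order of the reference tail;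
    -- the bare bound η would not do.
    have h2 : P.real R₂ ≤ η * P.real {ω | ε * x < T ω} := by
      have hmT : MeasurableSet {ω | ε * x < T ω} := measurableSet_lt measurable_const hTm
      have h3 := measureReal_eq_integral_of_indepFun hNm hYm hNZ
        (E := fun n => {ζ | δ * x ≤ |partialSum n ζ - ∑ j, (∫ z, z ∂(H j)) * (n j : ℝ)| ∧
          ε * x < ∑ j, (n j : ℝ) ∧ ∑ j, (n j : ℝ) ≤ B * x}) fun n =>
        (measurableSet_le measurable_const
          ((measurable_partialSum n).sub_const _).abs).inter (.const _)
      refine (le_of_eq h3).trans ?_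
      have h4 : η * P.real {ω | ε * x < T ω} =
          ∫ ω, {ω | ε * x < T ω}.indicator (fun _ => η) ω ∂P := by
        rw [integral_indicator_const _ hmT, smul_eq_mul, mul_comm]
      rw [h4]
      refine integral_mono_of_nonneg (.of_forall fun ω => measureReal_nonneg)
        ((integrable_const η).indicator hmT) (.of_forall fun ω => ?_)
      by_cases h : ε * x < T ω ∧ T ω ≤ B * x
      · simp only
        rw [Set.indicator_of_mem (show ω ∈ {ω | ε * x < T ω} from h.1)]
        exact (measureReal_mono fun ω' hω' => hω'.1).trans (hx _ h.2)
      · have h5 : {ω' : Ω | (fun q : Fin p × ℕ => Z q.1 q.2 ω') ∈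
            {ζ | δ * x ≤ |partialSum (fun j => N j ω) ζ - ∑ j, (∫ z, z ∂(H j)) * (N j ω : ℝ)| ∧
              ε * x < ∑ j, (N j ω : ℝ) ∧ ∑ j, (N j ω : ℝ) ≤ B * x}} = ∅ := by
          ext ω'
          simp only [Set.mem_ofPred_eq, Set.mem_empty_iff_false, iff_false]
          exact fun h6 => h h6.2
        simp only
        rw [h5, measureReal_empty]
        exact Set.indicator_nonneg (fun _ _ => hη.le) _
    have h3 : P.real R₃ = P.real {ω | (1 - δ) * x < U ω} - P.real {ω | (1 + δ) * x < U ω} := by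
      refine measureReal_sdiff (fun ω hω => ?_) (measurableSet_lt measurable_const hUm)
      simp only [Set.mem_ofPred_eq] at hω ⊢
      nlinarith
    have hR : P.real (R₁ ∪ R₂ ∪ R₃) ≤ P.real R₁ + η * P.real {ω | ε * x < T ω} +
        (P.real {ω | (1 - δ) * x < U ω} - P.real {ω | (1 + δ) * x < U ω}) := by
      have h4 := measureReal_union_le (μ := P) (R₁ ∪ R₂) R₃
      have h5 := measureReal_union_le (μ := P) R₁ R₂
      linarith
    have hclose : ∀ ω, ω ∉ R₁ ∪ R₂ ∪ R₃ → ε * x < T ω →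
        |S ω - U ω| < δ * x ∧ ((1 - δ) * x < U ω → (1 + δ) * x < U ω) := by
      intro ω hω hTω
      simp only [Set.mem_union, not_or] at hω
      obtain ⟨⟨h4, h5⟩, h6⟩ := hω
      refine ⟨?_, fun h7 => ?_⟩
      · by_contra! h7
        exact h5 ⟨h7, hTω, not_lt.1 h4⟩
      · by_contra h8
        exact h6 ⟨h7, h8⟩
    have hδx : 0 < δ * x := by positivity
    have hAB : {ω | x < S ω ∧ ε * x < T ω} ⊆ {ω | x < U ω} ∪ (R₁ ∪ R₂ ∪ R₃) := by
      rintro ω ⟨h4, h5⟩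
      by_cases h6 : ω ∈ R₁ ∪ R₂ ∪ R₃
      · exact Or.inr h6
      · obtain ⟨h7, h8⟩ := hclose ω h6 h5
        have h9 := abs_lt.1 h7
        have h10 := h8 (by linarith)
        refine Or.inl ?_
        rw [Set.mem_ofPred_eq]
        linarith
    have hBA : {ω | x < U ω} ⊆ {ω | x < S ω ∧ ε * x < T ω} ∪ (R₁ ∪ R₂ ∪ R₃) := by
      intro ω (h4 : x < U ω)
      by_cases h6 : ω ∈ R₁ ∪ R₂ ∪ R₃
      · exact Or.inr h6
      -- U ≤ M T, with M the sum of the absolute means, and Mε ≤ 1: thus U > x already forces T >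
      -- εx.
      · have h5 : ε * x < T ω := by
          by_contra! h5
          have h7 := mul_le_mul_of_nonneg_left h5
            (Finset.sum_nonneg fun j (_ : j ∈ Finset.univ) => abs_nonneg (∫ z, z ∂(H j)))
          have h8 := mul_le_mul_of_nonneg_right hεH hx0.le
          have := hUT ω
          linarith
        obtain ⟨h7, h8⟩ := hclose ω h6 h5
        have h9 := abs_lt.1 h7
        have h10 := h8 (by linarith)
        exact Or.inl ⟨by linarith, h5⟩
    have h4 := (measureReal_mono (μ := P) hAB).trans (measureReal_union_le _ _)
    have h5 := (measureReal_mono (μ := P) hBA).trans (measureReal_union_le _ _)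
    rw [abs_le]
    constructor <;> linarith
  unfold TailEquiv
  refine Metric.tendsto_nhds.2 fun θ hθ => ?_
  -- B, δ and η are chosen so that each of the three error terms has limit below θ/4 relative to the
  -- reference tail.
  have hBlim : Tendsto (fun B : ℝ => b * B ^ (-α)) atTop (𝓝 (b * 0)) :=
    (tendsto_rpow_neg_atTop hF.1).const_mul b
  rw [mul_zero] at hBlim
  obtain ⟨B, hBθ, hB⟩ := ((hBlim.eventually_lt_const (by positivity : 0 < θ / 4)).and
    (eventually_gt_atTop 0)).exists
  have hδlim : Tendsto (fun δ : ℝ => d * (1 - δ) ^ (-α) - d * (1 + δ) ^ (-α)) (𝓝[>] 0) (𝓝 0) := by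
    have h1 : ContinuousAt (fun δ : ℝ => d * (1 - δ) ^ (-α) - d * (1 + δ) ^ (-α)) 0 :=
      (continuousAt_const.mul (ContinuousAt.rpow_const (by fun_prop) (Or.inl (by simp)))).sub
        (continuousAt_const.mul (ContinuousAt.rpow_const (by fun_prop) (Or.inl (by simp))))
    have := h1.tendsto
    simp only [sub_zero, add_zero, sub_self] at this
    exact this.mono_left nhdsWithin_le_nhds
  obtain ⟨δ, hδθ, hδ, hδ1⟩ := ((hδlim.eventually_lt_const (by positivity : 0 < θ / 4)).and
    (Ioo_mem_nhdsGT (zero_lt_one' ℝ))).exists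
  have hε' : 0 ≤ b * ε ^ (-α) := mul_nonneg hb0 (Real.rpow_nonneg hε.le _)
  set η := θ / 4 / (b * ε ^ (-α) + 1) with hη
  have hη0 : 0 < η := by positivity
  have hηθ : η * (b * ε ^ (-α)) < θ / 4 := by
    rw [hη, div_mul_eq_mul_div, div_lt_iff₀ (by positivity)]
    nlinarith
  have hlim := ((hb.comp_mul hF hB).add ((hb.comp_mul hF hε).const_mul η)).add
    ((hd.comp_mul hF (sub_pos.2 hδ1)).sub (hd.comp_mul hF (t := 1 + δ) (by linarith)))
  filter_upwards [hbound B hB δ hδ hδ1 η hη0,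
    hlim.eventually_lt_const (show _ < θ by linarith)] with x h1 h2
  have hp := hF.tail_pos x
  rw [Real.dist_eq, sub_zero, abs_div, abs_of_pos hp]
  refine lt_of_le_of_lt ?_ h2
  rw [div_le_iff₀ hp]
  refine h1.trans (le_of_eq ?_)
  field_simp
  rfl

end Main

end RandomSum

end

/-! ### Assembly -/

theorem mainTheorem4
    {Ω : Type*} [MeasurableSpace Ω] (P : Measure Ω) [IsProbabilityMeasure P]
    -- the reference distribution: regularly varying with finite mean
    (F : Measure ℝ) [IsProbabilityMeasure F] (α : ℝ)
    (hF : RandomSum.IsRegularlyVarying F α) (hFmean : Integrable (fun z : ℝ => z) F)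
    -- the counting vector
    (p : ℕ) (N : Fin p → Ω → ℕ) (hN : ∀ j, Measurable (N j)) (cN : ℝ)
    (hMRV : RandomSum.MRV P F (fun ω j => (N j ω : ℝ)) cN)
    -- the summands
    (Z : Fin p → ℕ → Ω → ℝ) (hZ : ∀ j m, Measurable (Z j m))
    (hZindep : iIndepFun (fun (q : Fin p × ℕ) => Z q.1 q.2) P)
    (hNZ : IndepFun (fun ω (j : Fin p) => N j ω) (fun ω (q : Fin p × ℕ) => Z q.1 q.2 ω) P)
    (Fj : Fin p → Measure ℝ) (hlaw : ∀ j m, P.map (Z j m) = Fj j)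
    (hmean : ∀ j, Integrable (fun z : ℝ => z) (Fj j))
    (zbar : Fin p → ℝ) (hzbar : ∀ j, zbar j = ∫ z, z ∂(Fj j))
    (c : Fin p → ℝ)
    (hc : ∀ j, RandomSum.TailEquiv (RandomSum.tail (Fj j)) (c j) (RandomSum.tail F)) :
    (∀ j, Integrable (fun ω => (N j ω : ℝ)) P) ∧
    -- the expansion, with an error which is negligible with respect to the reference tail
    (fun x : ℝ => P.real {ω | x < ∑ j, RandomSum.randomSum (Z j) (N j) ω} -
        (P.real {ω | x < ∑ j, zbar j * (N j ω : ℝ)} +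
          (∑ j, c j * ∫ ω, (N j ω : ℝ) ∂P) * RandomSum.tail F x))
      =o[atTop] RandomSum.tail F ∧
    -- asymptotic equivalence, unless both sides are negligible with respect to the reference tail
    (¬ ((fun x : ℝ => P.real {ω | x < ∑ j, zbar j * (N j ω : ℝ)} +
          (∑ j, c j * ∫ ω, (N j ω : ℝ) ∂P) * RandomSum.tail F x)
        =o[atTop] RandomSum.tail F) →
      (fun x : ℝ => P.real {ω | x < ∑ j, RandomSum.randomSum (Z j) (N j) ω})
        ~[atTop]
      (fun x : ℝ => P.real {ω | x < ∑ j, zbar j * (N j ω : ℝ)} +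
          (∑ j, c j * ∫ ω, (N j ω : ℝ) ∂P) * RandomSum.tail F x)) := by
  have hNm : Measurable fun ω j => (N j ω : ℝ) :=
    measurable_pi_lambda _ fun j => measurable_from_nat.comp (hN j)
  have hT : RandomSum.TailEquiv (fun x => P.real {ω | x < ∑ j, (N j ω : ℝ)}) cN
      (RandomSum.tail F) := by
    simpa only [RandomSum.norm₁_natCast] using hMRV.1
  have hTi : Integrable (fun ω => ∑ j, (N j ω : ℝ)) P :=
    RandomSum.integrable_of_eventually_le_tail hFmean
      (Finset.measurable_sum _ fun j _ => measurable_from_nat.comp (hN j))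
      (fun ω => Finset.sum_nonneg fun j _ => Nat.cast_nonneg _)
      (hT.eventually_le hF (lt_add_one cN))
  have hNi : ∀ j, Integrable (fun ω => (N j ω : ℝ)) P := fun j =>
    hTi.mono' (measurable_from_nat.comp (hN j)).aestronglyMeasurable (.of_forall fun ω => by
      rw [Real.norm_of_nonneg (Nat.cast_nonneg _)]
      exact Finset.single_le_sum (f := fun j => (N j ω : ℝ)) (fun j _ => Nat.cast_nonneg _)
        (Finset.mem_univ j))
  obtain rfl : zbar = fun j => ∫ z, z ∂(Fj j) := funext hzbar
  obtain ⟨d, _, hd⟩ := hMRV.exists_tailEquiv_linear hF hNm fun j => ∫ z, z ∂(Fj j)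
  set c₀ := ∑ j, c j * ∫ ω, (N j ω : ℝ) ∂P with hc₀
  have hpos := hF.tail_pos
  have hexp : (fun x : ℝ => P.real {ω | x < ∑ j, RandomSum.randomSum (Z j) (N j) ω} -
      (P.real {ω | x < ∑ j, (∫ z, z ∂(Fj j)) * (N j ω : ℝ)} + c₀ * RandomSum.tail F x))
      =o[atTop] RandomSum.tail F := by
    obtain ⟨ε₀, hε₀, hsmall⟩ := RandomSum.exists_tailEquiv_randomSum_small hF hN hNi hZ hZindep
      hNZ hlaw hmean hc
    set M := ∑ j, |∫ z, z ∂(Fj j)| with hM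
    have hM0 : 0 ≤ M := Finset.sum_nonneg fun j _ => abs_nonneg _
    -- One ε must serve both regimes: ε ≤ ε₀ for the uniform bound, and Mε ≤ 1 so that U > x occurs
    -- only among many summands.
    set ε := min ε₀ (1 / (M + 1)) with hε
    have hε0 : 0 < ε := by positivity
    have hεM : M * ε ≤ 1 := by
      calc M * ε ≤ M * (1 / (M + 1)) := by gcongr; exact min_le_right _ _
        _ ≤ 1 := by
          rw [mul_one_div, div_le_one (by positivity)]
          linarith
    have h1 := hsmall ε hε0 (min_le_left _ _)
    have h2 := RandomSum.tailEquiv_randomSum_large hF hN hT hd hZ hZindep hNZ hlaw hmean hε0 hεM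
    rw [isLittleO_iff_tendsto fun x hx => absurd hx (hpos x).ne']
    have h3 := (h1.add h2).sub_const c₀
    rw [add_zero, sub_self] at h3
    refine h3.congr fun x => ?_
    have hsplit : P.real {ω | x < ∑ j, RandomSum.randomSum (Z j) (N j) ω} =
        P.real {ω | x < ∑ j, RandomSum.randomSum (Z j) (N j) ω ∧ ∑ j, (N j ω : ℝ) ≤ ε * x} +
        P.real {ω | x < ∑ j, RandomSum.randomSum (Z j) (N j) ω ∧
          ε * x < ∑ j, (N j ω : ℝ)} := by
      have hm : MeasurableSet {ω | ∑ j, (N j ω : ℝ) ≤ ε * x} :=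
        measurableSet_le (Finset.measurable_sum _ fun j _ => measurable_from_nat.comp (hN j))
          measurable_const
      rw [← measureReal_inter_add_sdiff (μ := P)
        (s := {ω | x < ∑ j, RandomSum.randomSum (Z j) (N j) ω}) hm]
      congr 2
      ext ω
      simp
    rw [hsplit]
    have := (hpos x).ne'
    field_simp
    ring
  -- The right-hand side divided by the reference tail converges to d + c₀. Non-negligibility makes
  -- this limit nonzero, so the reference tail is O of the right-hand side and the error is
  -- negligible against it.
  refine ⟨hNi, hexp, fun hnot => hexp.trans_isBigO ?_⟩
  have hrhs : Tendsto (fun x => (P.real {ω | x < ∑ j, (∫ z, z ∂(Fj j)) * (N j ω : ℝ)} +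
      c₀ * RandomSum.tail F x) / RandomSum.tail F x) atTop (𝓝 (d + c₀)) := by
    refine (hd.add_const c₀).congr fun x => ?_
    have := (hpos x).ne'
    field_simp
  have hne : d + c₀ ≠ 0 := fun h => hnot <| by
    rw [isLittleO_iff_tendsto fun x hx => absurd hx (hpos x).ne']
    rwa [h] at hrhs
  have hinv := hrhs.inv₀ hne
  refine isBigO_of_div_tendsto_nhds ?_ _ (hinv.congr fun x => by rw [inv_div]; rfl)
  filter_upwards [hrhs.eventually_ne hne] with x hx h0
  exact absurd (by rw [h0, zero_div]) hx
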